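/- **Setting.** Let $(\Omega,\mathcal F,\mathbb P)$ be a probability space with a filtration $(\mathcal F_t)_{t\in\mathbb N}$, let $z_\ast\in\mathbb R^d$, and let $u_t=S_tz_\ast+w_t$, where $S_t$ is a random $p\times d$ matrix, $S_t$ and $u_t$ are $\mathcal F_t$-measurable, and $w_{t}\sim\mathcal N(0,\Gamma)$ ($\Gamma$ symmetric positive definite) with $w_{t+1}$ independent of $\sigma(\mathcal F_t,S_{t+1})$. Put $A_t=S_t^\top S_t$ and suppose $\|A_t\|\le A_{\max}$ almost surely for all $t\ge 1$. **Ergodic data.** There are a symmetric matrix $0\preceq A\preceq I$ in $\mathbb R^{d\times d}$ and, for each $\varepsilon>0$, an integer $\tau_\varepsilon\ge1$ with $\tau_\varepsilon\ge c\,|\log\varepsilon^{-1}|$ (for some $c>0$ not depending on $\varepsilon$) such that almost surely, in operator norm, $$\|\mathbb E[A_{t+1+\tau_\varepsilon}\mid\mathcal F_t]-A\|\le\varepsilon\qquad\text{for all }t\ge1 .$$ **Algorithm.** Let $\alpha>0$, $h>0$, let $z_0^{(1)},\dots,z_0^{(J)}$ be square-integrable random vectors in $\mathbb R^d$, and for $t\ge0$,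 $1\le j\le J$ let $$z_{t+1}^{(j)}=z_t^{(j)}-h\,C_t\big(S_{t+1}^\top(S_{t+1}z_t^{(j)}-u_{t+1})+\alpha z_t^{(j)}\big),$$ $$\bar z_t=\frac1J\sum_{j=1}^J z_t^{(j)},\qquad C_t=\frac1J\sum_{j=1}^J (z_t^{(j)}-\bar z_t)(z_t^{(j)}-\bar z_t)^\top .$$ Assume that $C_0\succ\sigma_l I$ almost surely for some $\sigma_l>0$ with $\lambda:=2\alpha\sigma_l\in(0,1)$, and that almost surely $$h\le\min\Big(\frac{\alpha}{J(A_{\max}+\alpha)^2},\frac J\alpha\Big)E_0^{-1},\qquad E_0=\frac1J\sum_{j=1}^J\|z_0^{(j)}-\bar z_0\|^2 .$$ Let $\mathcal J(z)=\tfrac12(z-z_\ast)^\top A(z-z_\ast)+\tfrac\alpha2\|z\|^2$, whose minimizer is $z^{\rm opt}=(A+\alpha I)^{-1}Az_\ast$. **Theorem.** For every $T$ the excess loss $\mathcal J(\bar z_T)-\mathcal J(z^{\rm opt})$ is integrable, and there is a constant $K$, independent of $\varepsilon$ and $T$, such that for all $\varepsilon>0$ and all integers $T\ge1$ $$\mathbb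 E[\mathcal J(\bar z_T)-\mathcal J(z^{\rm opt})]\le K\Big(\varepsilon+\frac{1+\tau_\varepsilon(1+\log\tau_\varepsilon+\log T)}{T^\lambda}\Big).$$ In particular, if $\tau_{1/T}=O(\log T)$ as $T\to\infty$, then, with the choice $\varepsilon=1/T$, $$\mathbb E[\mathcal J(\bar z_T)-\mathcal J(z^{\rm opt})]=O\Big(\frac{\log(T)^2}{T^\lambda}\Big).$$ -/

import Mathlib

open MeasureTheory ProbabilityTheory Filter Asymptotics
open scoped RealInnerProductSpace

namespace DEKI

noncomputable section

/-- The Euclidean space `ℝⁿ`; a real `p × d` matrix is a linear map `Vec d →L[ℝ] Vec p`. -/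
abbrev Vec (n : ℕ) : Type := EuclideanSpace ℝ (Fin n)

/-- The ensemble mean `z̄ = J⁻¹ ∑ⱼ z⁽ʲ⁾`. -/
def mean {J d : ℕ} (z : Fin J → Vec d) : Vec d := (J : ℝ)⁻¹ • ∑ j, z j

/-- The ensemble spread `e⁽ʲ⁾ = z⁽ʲ⁾ - z̄`. -/
def spread {J d : ℕ} (z : Fin J → Vec d) (j : Fin J) : Vec d := z j - mean z

/-- The sample covariance `C = J⁻¹ ∑ⱼ (z⁽ʲ⁾ - z̄)(z⁽ʲ⁾ - z̄)ᵀ`. -/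
def cov {J d : ℕ} (z : Fin J → Vec d) : Vec d →L[ℝ] Vec d :=
  (J : ℝ)⁻¹ • ∑ j, InnerProductSpace.rankOne ℝ (spread z j) (spread z j)

/-- The mean squared spread `E = J⁻¹ ∑ⱼ ‖e⁽ʲ⁾‖²`. -/
def spreadEnergy {J d : ℕ} (z : Fin J → Vec d) : ℝ := (J : ℝ)⁻¹ * ∑ j, ‖spread z j‖ ^ 2

/-- The normal operator `Sᵀ S`. -/
def normalOp {d p : ℕ} (S : Vec d →L[ℝ] Vec p) : Vec d →L[ℝ] Vec d :=
  (ContinuousLinearMap.adjoint S).comp S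

/-- The strict Loewner order statement `C ≻ σ I`. -/
def CovGT {d : ℕ} (C : Vec d →L[ℝ] Vec d) (σ : ℝ) : Prop :=
  ∀ v : Vec d, v ≠ 0 → σ * ‖v‖ ^ 2 < ⟪v, C v⟫

/-- One step of DEKI with unperturbed observation `u`, forward operator `S`, step size `h`:
`z⁽ʲ⁾ ↦ z⁽ʲ⁾ - h C (Sᵀ (S z⁽ʲ⁾ - u) + α z⁽ʲ⁾)`. -/
def step {J d p : ℕ} (α h : ℝ) (S : Vec d →L[ℝ] Vec p) (u : Vec p) (z : Fin J → Vec d) :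
    Fin J → Vec d :=
  fun j => z j - h • cov z (ContinuousLinearMap.adjoint S (S (z j) - u) + α • z j)

/-- The DEKI ensemble: the step from time `t` to `t + 1` uses `S (t + 1)` and `u (t + 1)`. -/
def ensemble {J d p : ℕ} (α h : ℝ) (S : ℕ → Vec d →L[ℝ] Vec p) (u : ℕ → Vec p)
    (z₀ : Fin J → Vec d) : ℕ → Fin J → Vec d
  | 0 => z₀
  | t + 1 => step α h (S (t + 1)) (u (t + 1)) (ensemble α h S u z₀ t)

/-- The observation `u_t = S_t z⋆ + w_t`. -/
def obs {Ω : Type*} {d p : ℕ} (S : ℕ → Ω → Vec d →L[ℝ] Vec p) (w : ℕ → Ω → Vec p)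
    (zstar : Vec d) (t : ℕ) (ω : Ω) : Vec p := S t ω zstar + w t ω

/-- The random DEKI ensemble driven by the observations `obs S w zstar`. -/
def process {Ω : Type*} {J d p : ℕ} (α h : ℝ) (S : ℕ → Ω → Vec d →L[ℝ] Vec p)
    (w : ℕ → Ω → Vec p) (zstar : Vec d) (z₀ : Ω → Fin J → Vec d) (t : ℕ) (ω : Ω) :
    Fin J → Vec d :=
  ensemble α h (fun s => S s ω) (fun s => obs S w zstar s ω) (z₀ ω) t

/-- The Tikhonov loss `½ (z - z⋆)ᵀ A (z - z⋆) + (α/2) ‖z‖²`, with gradient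
`(A + α I) z - A z⋆`. -/
def loss {d : ℕ} (A : Vec d →L[ℝ] Vec d) (α : ℝ) (zstar z : Vec d) : ℝ :=
  1 / 2 * ⟪z - zstar, A (z - zstar)⟫ + α / 2 * ‖z‖ ^ 2

/-- The optimal parameter `(A + α I)⁻¹ A z⋆`. -/
def zopt {d : ℕ} (A : Vec d →L[ℝ] Vec d) (α : ℝ) (zstar : Vec d) : Vec d :=
  (A + α • (1 : Vec d →L[ℝ] Vec d)).inverse (A zstar)

/-- `zopt` solves the normal equation `(A + α I) z = A z⋆`. -/
theorem zopt_eq {d : ℕ} {A : Vec d →L[ℝ] Vec d} {α : ℝ} (hA : 0 ≤ A) (hα : 0 < α)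
    (zstar : Vec d) : A (zopt A α zstar) + α • zopt A α zstar = A zstar := by
  have hpos := (ContinuousLinearMap.nonneg_iff_isPositive A).1 hA
  have hinj : Function.Injective (A + α • (1 : Vec d →L[ℝ] Vec d)).toLinearMap := by
    rw [← LinearMap.ker_eq_bot, LinearMap.ker_eq_bot']
    intro v hv
    have h1 : A v + α • v = 0 := by simpa using hv
    have h2 : ⟪A v, v⟫ + α * ‖v‖ ^ 2 = 0 := by
      have h3 := congrArg (fun x => ⟪x, v⟫) h1
      simpa [inner_add_left, inner_smul_left] using h3
    have h4 : 0 ≤ ⟪A v, v⟫ := by simpa using hpos.inner_nonneg_left v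
    have h5 : ‖v‖ ^ 2 = 0 := by nlinarith [sq_nonneg ‖v‖]
    simpa using h5
  let e := (LinearEquiv.ofInjectiveEndo _ hinj).toContinuousLinearEquiv
  have he : (e : Vec d →L[ℝ] Vec d) = A + α • (1 : Vec d →L[ℝ] Vec d) := by
    ext1 v; rfl
  have h6 : (A + α • (1 : Vec d →L[ℝ] Vec d)) (zopt A α zstar) = A zstar := by
    unfold zopt
    rw [← he, ContinuousLinearMap.inverse_equiv]
    simp
  simpa using h6

/-- `zopt` is a global minimizer of the loss, so `loss z - loss zopt` is the excess loss. -/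
theorem loss_zopt_le {d : ℕ} {A : Vec d →L[ℝ] Vec d} {α : ℝ} (hA : 0 ≤ A) (hα : 0 < α)
    (zstar z : Vec d) : loss A α zstar (zopt A α zstar) ≤ loss A α zstar z := by
  have hpos := (ContinuousLinearMap.nonneg_iff_isPositive A).1 hA
  have h0 := zopt_eq hA hα zstar
  generalize zopt A α zstar = y at h0 ⊢
  obtain ⟨x, rfl⟩ : ∃ x, z = y + x := ⟨z - y, by abel⟩
  have hs : ⟪x, A (y - zstar)⟫ + α * ⟪x, y⟫ = 0 := by
    have h1 : A (y - zstar) + α • y = 0 := by rw [map_sub, ← h0]; abel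
    have h2 := congrArg (fun v => ⟪x, v⟫) h1
    simpa [inner_add_right, inner_smul_right] using h2
  have hsym : ⟪y - zstar, A x⟫ = ⟪x, A (y - zstar)⟫ := by
    rw [real_inner_comm]; exact hpos.isSymmetric x (y - zstar)
  have hx : 0 ≤ ⟪x, A x⟫ := by simpa using hpos.inner_nonneg_right x
  have e1 : y + x - zstar = (y - zstar) + x := by abel
  have e2 : ‖y + x‖ ^ 2 = ‖y‖ ^ 2 + 2 * ⟪x, y⟫ + ‖x‖ ^ 2 := by
    rw [norm_add_sq_real, real_inner_comm]
  unfold loss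
  rw [e1, e2, map_add, inner_add_left, inner_add_right, inner_add_right, hsym]
  nlinarith [mul_nonneg hα.le (sq_nonneg ‖x‖)]

/-- Ergodic data: `S_t` is adapted, `0 ⪯ A ⪯ I`, and for every `ε > 0` the lag `τ ε ≥ 1`, at least
a fixed multiple of `|log ε⁻¹|`, satisfies
`‖E[S_{t+1+τ ε}ᵀ S_{t+1+τ ε} ∣ ℱ_t] - A‖ ≤ ε` almost surely for all `t ≥ 1`
(operator norm). -/
structure ErgodicData {Ω : Type*} {m : MeasurableSpace Ω} (P : Measure Ω) (ℱ : Filtration ℕ m)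
    {d p : ℕ} (S : ℕ → Ω → Vec d →L[ℝ] Vec p) (A : Vec d →L[ℝ] Vec d) (τ : ℝ → ℕ) : Prop where
  adapted : ∀ t, Measurable[ℱ t] (S t)
  nonneg : 0 ≤ A
  le_one : A ≤ 1
  tau_pos : ∀ ε : ℝ, 0 < ε → 0 < τ ε
  tau_lower : ∃ c : ℝ, 0 < c ∧ ∀ ε : ℝ, 0 < ε → c * |Real.log ε⁻¹| ≤ τ ε
  mixing : ∀ ε : ℝ, 0 < ε → ∀ t : ℕ, 1 ≤ t →
    ∀ᵐ ω ∂P, ‖(P[fun ω' => normalOp (S (t + 1 + τ ε) ω') | ℱ t]) ω - A‖ ≤ ε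

/-- Observation noise: for every `t`, `w_{t+1} ∼ N(0, Γ)` is independent of the past `ℱ_t` and the
current forward operator `S_{t+1}`, jointly. -/
structure GaussianNoise {Ω : Type*} {m : MeasurableSpace Ω} (P : Measure Ω) (ℱ : Filtration ℕ m)
    {d p : ℕ} (S : ℕ → Ω → Vec d →L[ℝ] Vec p) (w : ℕ → Ω → Vec p)
    (Γ : Matrix (Fin p) (Fin p) ℝ) : Prop where
  law : ∀ t, HasLaw (w (t + 1)) (multivariateGaussian 0 Γ) P
  indep : ∀ t, Indep (MeasurableSpace.comap (w (t + 1)) inferInstance)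
    (ℱ t ⊔ MeasurableSpace.comap (S (t + 1)) inferInstance) P

end

end DEKI

/-!
Write `y t` for the ensemble mean minus `zopt`, `v = zopt - zstar`, and
`ξ t = (S (t+1)ᵀ S (t+1) - A) v - S (t+1)ᵀ w (t+1)`. The normal equation for `zopt` turns the
recursion for the mean into `y (t+1) = G t (y t) - h C t (ξ t)` with
`G t = 1 - h C t (S (t+1)ᵀ S (t+1) + α)`, and the spreads obey the homogeneous recursion with the
same `G t`. So if `F t` is the frame map `a ↦ J^(-1/2) ∑ⱼ aⱼ e⁽ʲ⁾ t`, for which `C t = F t (F t)†`,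
then `F (t+1) = G t ∘ F t`, and the coefficients `a t` of `y t = F t (a t)` are constant up to the
forcing `ξ`. They exist at time `0` because `C 0 ≻ σ`. Decay of `y` is therefore inherited from
decay of the frame: each quadratic form `q t = ‖(F t)† x‖²` on a unit vector `x` satisfies
`q (t+1) ≤ q t - h α (q t)²`, whence `‖F t‖² ≤ 1 / (h α (t+1))` (`FrameFlow.norm_sq_le`).

Summation by parts moves the forcing onto its partial sums `X t = ξ 0 + ⋯ + ξ (t-1)`: consecutive
coefficients differ by `O(t^(-3/2))`, so pathwise (`FrameFlow.norm_le`)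
`‖y T‖ ≤ c T^(-1/2) (‖a 0‖ + ∑ₜ t^(-3/2) ‖X t‖ + T^(-1/2) ‖X T‖)`.
The partial sums `X t` do not involve the ensemble, so only their second moments are needed, and no
measurability of the initial ensemble with respect to the filtration enters. The noise terms are
uncorrelated, and the terms `(S (t+1)ᵀ S (t+1) - A) v` have covariance `O(ε)` at distance more than
`τ ε`, so `E ‖X t‖² ≤ B (τ ε * t + ε * t²)` (`exists_integral_norm_sum_drive_sq_le`).
A Cauchy–Schwarz inequality with weights `t^(-lam)`, whose sum up to `T` is `O(T^(1 - lam))`, then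
gives the bound `K (ε + (1 + τ ε) / T^lam)` for the expected excess loss, for any `lam` in `(0, 1)`.
-/

/-! ### Decay and summation by parts for an abstract frame recursion -/

namespace DEKI

/-- The recursion `F (t+1) = (1 - h F (F†) M) F` of the synthesis operators of a frame, with
`C = F F†` as preconditioner and self-adjoint operators `M t` satisfying `α ≤ M t` and `‖M t‖ ≤ m`.
The bound `init` makes the step size so small, relative to the initial frame, that `‖F t‖` is
nonincreasing; hence the same bound holds at all times. -/
structure FrameFlow {V H : Type*} [NormedAddCommGroup V] [InnerProductSpace ℝ V]
    [CompleteSpace V] [NormedAddCommGroup H] [InnerProductSpace ℝ H] [CompleteSpace H]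
    (α m h : ℝ) (M : ℕ → H →L[ℝ] H) (F : ℕ → V →L[ℝ] H) : Prop where
  alpha_pos : 0 < α
  alpha_le : α ≤ m
  h_pos : 0 < h
  symm : ∀ t x y, ⟪M t x, y⟫ = ⟪x, M t y⟫
  lower : ∀ t x, α * ‖x‖ ^ 2 ≤ ⟪x, M t x⟫
  upper : ∀ t, ‖M t‖ ≤ m
  init : h * m ^ 2 * ‖F 0‖ ^ 2 ≤ α / 2
  succ : ∀ t, F (t + 1)
    = F t - h • (F t ∘L ContinuousLinearMap.adjoint (F t) ∘L M t ∘L F t)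

section Flow

open ContinuousLinearMap

variable {V H : Type*} [NormedAddCommGroup V] [InnerProductSpace ℝ V]
  [CompleteSpace V] [NormedAddCommGroup H] [InnerProductSpace ℝ H] [CompleteSpace H]
  {α m h : ℝ} {M : ℕ → H →L[ℝ] H} {F : ℕ → V →L[ℝ] H}

theorem FrameFlow.adjoint_succ (hF : FrameFlow α m h M F) (t : ℕ) (v : H) :
    adjoint (F (t + 1)) v
      = adjoint (F t) (v - h • M t (F t (adjoint (F t) v))) := by
  refine ext_inner_right ℝ fun a => ?_
  rw [adjoint_inner_left, hF.succ t, adjoint_inner_left]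
  simp only [sub_apply, smul_apply, comp_apply, inner_sub_left, inner_sub_right, inner_smul_left,
    inner_smul_right, hF.symm, RCLike.conj_to_real]
  rw [← adjoint_inner_left (F t), ← adjoint_inner_left (F t) (adjoint (F t) _),
    adjoint_inner_right, adjoint_inner_left]

/-- The quadratic form of the covariance `F F†` decreases by at least `h α ‖F F† v‖²`: the
first-order decrease is twice that, and the step-size bound makes the second-order term cost at most
half of it. -/
theorem FrameFlow.norm_adjoint_succ_sq_le (hF : FrameFlow α m h M F) {t : ℕ}
    (hm : h * m ^ 2 * ‖F t‖ ^ 2 ≤ α) (v : H) :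
    ‖adjoint (F (t + 1)) v‖ ^ 2
      ≤ ‖adjoint (F t) v‖ ^ 2 - h * α * ‖F t (adjoint (F t) v)‖ ^ 2 := by
  have hh := hF.h_pos
  have hα := hF.alpha_pos
  set c := F t (adjoint (F t) v) with hc
  have h1 : ⟪adjoint (F t) v, adjoint (F t) (M t c)⟫ = ⟪c, M t c⟫ := by
    rw [adjoint_inner_right]
  have h2 : ‖adjoint (F t) (M t c)‖ ≤ ‖F t‖ * (m * ‖c‖) := by
    calc ‖adjoint (F t) (M t c)‖ ≤ ‖adjoint (F t)‖ * ‖M t c‖ := le_opNorm _ _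
      _ = ‖F t‖ * ‖M t c‖ := by rw [LinearIsometryEquiv.norm_map]
      _ ≤ ‖F t‖ * (m * ‖c‖) := by gcongr; exact (M t).le_of_opNorm_le (hF.upper t) c
  have h3 : ‖adjoint (F t) (M t c)‖ ^ 2 ≤ (‖F t‖ * (m * ‖c‖)) ^ 2 := by gcongr
  have h4 := hF.lower t c
  rw [hF.adjoint_succ t v, map_sub, map_smul, norm_sub_sq_real, inner_smul_right, h1, norm_smul,
    Real.norm_of_nonneg hh.le]
  have h5 : (h * ‖adjoint (F t) (M t c)‖) ^ 2 ≤ h * α * ‖c‖ ^ 2 := by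
    calc (h * ‖adjoint (F t) (M t c)‖) ^ 2 = h ^ 2 * ‖adjoint (F t) (M t c)‖ ^ 2 := by ring
      _ ≤ h ^ 2 * (‖F t‖ * (m * ‖c‖)) ^ 2 := by gcongr
      _ = h * (h * m ^ 2 * ‖F t‖ ^ 2) * ‖c‖ ^ 2 := by ring
      _ ≤ h * α * ‖c‖ ^ 2 := by gcongr
  nlinarith [mul_le_mul_of_nonneg_left h4 hh.le]

theorem FrameFlow.norm_succ_le (hF : FrameFlow α m h M F) {t : ℕ}
    (hm : h * m ^ 2 * ‖F t‖ ^ 2 ≤ α) : ‖F (t + 1)‖ ≤ ‖F t‖ := by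
  have hh := hF.h_pos
  have hα := hF.alpha_pos
  rw [← LinearIsometryEquiv.norm_map adjoint (F (t + 1)),
    ← LinearIsometryEquiv.norm_map adjoint (F t)]
  refine opNorm_le_bound _ (norm_nonneg _) fun v => ?_
  refine le_trans ?_ (le_opNorm _ _)
  have h1 := hF.norm_adjoint_succ_sq_le hm v
  refine le_of_sq_le_sq ?_ (norm_nonneg _)
  have : 0 ≤ h * α * ‖F t (adjoint (F t) v)‖ ^ 2 := by positivity
  linarith

theorem FrameFlow.step_bound (hF : FrameFlow α m h M F) (t : ℕ) :
    h * m ^ 2 * ‖F t‖ ^ 2 ≤ α / 2 := by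
  induction t with
  | zero => exact hF.init
  | succ t ih =>
    have hh := hF.h_pos
    refine le_trans ?_ ih
    gcongr
    exact hF.norm_succ_le (ih.trans (by linarith [hF.alpha_pos]))

theorem FrameFlow.mul_norm_sq_le_half (hF : FrameFlow α m h M F) (t : ℕ) :
    h * m * ‖F t‖ ^ 2 ≤ 1 / 2 := by
  have hα := hF.alpha_pos
  have hm : 0 < m := hα.trans_le hF.alpha_le
  have h1 := hF.step_bound t
  have h2 : m * (h * m * ‖F t‖ ^ 2) ≤ m * (1 / 2) := by
    nlinarith [hF.alpha_le]
  exact le_of_mul_le_mul_left h2 hm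

theorem succ_mul_sub_sq_le_one {n x : ℝ} (hn : 0 ≤ n) (hx : 0 ≤ x) (h : n * x ≤ 1) :
    (n + 1) * (x - x ^ 2) ≤ 1 := by
  rcases le_total x 1 with h1 | h1
  · nlinarith [mul_nonneg hx (sub_nonneg.2 h1), mul_nonneg (sub_nonneg.2 h) (sub_nonneg.2 h1)]
  · nlinarith [mul_nonneg hx (sub_nonneg.2 h1)]

/-- The covariance decays like `1/t`, since `x = h α ‖F† v‖²` satisfies `x' ≤ x - x²` for unit
vectors `v`. -/
theorem FrameFlow.norm_sq_le (hF : FrameFlow α m h M F) (t : ℕ) :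
    ‖F t‖ ^ 2 ≤ (h * α * (t + 1))⁻¹ := by
  have hh := hF.h_pos
  have hα := hF.alpha_pos
  have key : ∀ v : H, ‖v‖ = 1 → (t + 1) * (h * α * ‖adjoint (F t) v‖ ^ 2) ≤ 1 := by
    intro v hv
    induction t with
    | zero =>
      have h1 : ‖adjoint (F 0) v‖ ≤ ‖F 0‖ := by
        have := le_opNorm (adjoint (F 0)) v
        rwa [LinearIsometryEquiv.norm_map, hv, mul_one] at this
      have h2 := hF.mul_norm_sq_le_half 0
      have h3 : h * α * ‖adjoint (F 0) v‖ ^ 2 ≤ h * m * ‖F 0‖ ^ 2 := by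
        have := hF.alpha_le
        have : 0 ≤ m := hα.le.trans this
        gcongr
      norm_num
      linarith
    | succ t ih =>
      have h1 := hF.norm_adjoint_succ_sq_le ((hF.step_bound t).trans (by linarith)) v
      have h2 : ‖adjoint (F t) v‖ ^ 2 ≤ ‖F t (adjoint (F t) v)‖ := by
        rw [← real_inner_self_eq_norm_sq, adjoint_inner_left]
        simpa [hv] using real_inner_le_norm v (F t (adjoint (F t) v))
      have h3 : (‖adjoint (F t) v‖ ^ 2) ^ 2 ≤ ‖F t (adjoint (F t) v)‖ ^ 2 := by gcongr
      have h4 := succ_mul_sub_sq_le_one (n := t + 1) (x := h * α * ‖adjoint (F t) v‖ ^ 2)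
        (by positivity) (by positivity) ih
      push_cast
      refine le_trans ?_ h4
      gcongr
      have h5 : h * α * (h * α * (‖adjoint (F t) v‖ ^ 2) ^ 2)
          ≤ h * α * (h * α * ‖F t (adjoint (F t) v)‖ ^ 2) := by gcongr
      have h6 := mul_le_mul_of_nonneg_left h1 (mul_pos hh hα).le
      nlinarith
  have h0 : ‖F t‖ ≤ √((h * α * (t + 1))⁻¹) := by
    rw [← LinearIsometryEquiv.norm_map adjoint (F t)]
    refine opNorm_le_of_unit_norm (Real.sqrt_nonneg _) fun v hv => ?_
    refine Real.le_sqrt_of_sq_le ?_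
    rw [← one_div, le_div_iff₀ (by positivity)]
    linarith [key v hv]
  calc ‖F t‖ ^ 2 ≤ √((h * α * (t + 1))⁻¹) ^ 2 := by gcongr
    _ = _ := Real.sq_sqrt (by positivity)

/-- Right inverse of `1 - N` for a small `N`, with the bounds of the Neumann series. -/
theorem exists_inverse_one_sub {N : H →L[ℝ] H} {θ : ℝ} (hN : ‖N‖ ≤ θ) (hθ : θ ≤ 1 / 2) :
    ∃ R : H →L[ℝ] H, (∀ x, R x - N (R x) = x) ∧ (∀ x, ‖R x‖ ≤ 2 * ‖x‖) ∧
      ∀ x, ‖R x - x‖ ≤ 2 * θ * ‖x‖ := by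
  have hlt : ‖N‖ < 1 := by linarith
  have h1 : ∀ x, (↑(Units.oneSub N hlt)⁻¹ : H →L[ℝ] H) x
      - N ((↑(Units.oneSub N hlt)⁻¹ : H →L[ℝ] H) x) = x := by
    intro x
    have := congrArg (fun L : H →L[ℝ] H => L x) (Units.mul_inv (Units.oneSub N hlt))
    simpa using this
  generalize (↑(Units.oneSub N hlt)⁻¹ : H →L[ℝ] H) = R at h1
  have h2 : ∀ x, ‖N (R x)‖ ≤ θ * ‖R x‖ := fun x => N.le_of_opNorm_le hN _
  have h3 : ∀ x, ‖R x‖ ≤ 2 * ‖x‖ := by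
    intro x
    have h4 : ‖R x‖ ≤ ‖x‖ + ‖N (R x)‖ := by
      calc ‖R x‖ = ‖x + N (R x)‖ := by rw [← sub_eq_iff_eq_add.1 (h1 x)]
        _ ≤ _ := norm_add_le _ _
    nlinarith [h2 x, norm_nonneg (R x)]
  refine ⟨R, h1, h3, fun x => ?_⟩
  have h0 : 0 ≤ θ := (norm_nonneg N).trans hN
  calc ‖R x - x‖ = ‖N (R x)‖ := by
        congr 1
        rw [sub_eq_iff_eq_add, add_comm, ← sub_eq_iff_eq_add]
        exact h1 x
    _ ≤ θ * ‖R x‖ := h2 x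
    _ ≤ θ * (2 * ‖x‖) := by gcongr; exact h3 x
    _ = 2 * θ * ‖x‖ := by ring

/-- Solutions of the recursion forced by `ξ` inherit the decay of the frame. In the frame the
solution has coefficients `a t` that change only by `-h F† R ξ`, where `R` inverts
`1 - h M F F†`; summation by parts then replaces `ξ` by its partial sums, at the cost of the
increments of `F† R`, which are smaller than `F†` by a factor of order `1/t`. -/
theorem FrameFlow.norm_le (hF : FrameFlow α m h M F) {y ξ : ℕ → H} {a₀ : V} (hy₀ : y 0 = F 0 a₀)
    (hy : ∀ t, y (t + 1) = y t - h • F t (adjoint (F t) (M t (y t) + ξ t)))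
    {ρ : ℕ → ℝ} (hρ : ∀ t, ‖F t‖ ≤ ρ t) (T : ℕ) :
    ‖y T‖ ≤ ρ T * (‖a₀‖ + ∑ t ∈ Finset.range T,
        6 * h * (m / α) * (ρ t / (t + 1)) * ‖∑ s ∈ Finset.range (t + 1), ξ s‖
      + 2 * h * ρ T * ‖∑ s ∈ Finset.range T, ξ s‖) := by
  have hh := hF.h_pos
  have hα := hF.alpha_pos
  have hm : 0 < m := hα.trans_le hF.alpha_le
  have hρ0 : ∀ t, 0 ≤ ρ t := fun t => (norm_nonneg _).trans (hρ t)
  have hadj : ∀ t v, ‖adjoint (F t) v‖ ≤ ρ t * ‖v‖ := fun t v =>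
    le_of_opNorm_le _ ((LinearIsometryEquiv.norm_map adjoint (F t)).trans_le (hρ t)) v
  set N : ℕ → H →L[ℝ] H := fun t => h • (M t ∘L F t ∘L adjoint (F t)) with hNdef
  have hNa : ∀ t v, N t v = h • M t (F t (adjoint (F t) v)) := fun t v => rfl
  set θ : ℕ → ℝ := fun t => h * m * ‖F t‖ ^ 2 with hθdef
  have hN : ∀ t, ‖N t‖ ≤ θ t := by
    intro t
    calc ‖N t‖ ≤ h * (‖M t‖ * (‖F t‖ * ‖adjoint (F t)‖)) := by
          rw [hNdef]
          simp only [norm_smul, Real.norm_of_nonneg hh.le]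
          gcongr
          exact (opNorm_comp_le _ _).trans (by gcongr; exact opNorm_comp_le _ _)
      _ ≤ h * (m * (‖F t‖ * ‖F t‖)) := by
          rw [LinearIsometryEquiv.norm_map]
          gcongr
          exact hF.upper t
      _ = θ t := by simp only [hθdef]; ring
  have hθ : ∀ t, θ t ≤ m / α / (t + 1) := by
    intro t
    calc h * m * ‖F t‖ ^ 2 ≤ h * m * (h * α * (t + 1))⁻¹ := by gcongr; exact hF.norm_sq_le t
      _ = m / α / (t + 1) := by field_simp
  have hθ' : ∀ t, θ (t + 1) ≤ m / α / (t + 1) := fun t =>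
    (hθ (t + 1)).trans (by gcongr; simp)
  choose R hR1 hR2 hR3 using fun t => exists_inverse_one_sub (hN t) (hF.mul_norm_sq_le_half t)
  have hFs : ∀ t v, adjoint (F (t + 1)) v = adjoint (F t) (v - N t v) :=
    fun t v => hF.adjoint_succ t v
  have hC : ∀ t v, F (t + 1) (adjoint (F t) (R t v)) = F t (adjoint (F t) v) := by
    intro t v
    nth_rewrite 2 [← hR1 t v]
    rw [hF.succ t]
    simp [hNa]
  -- the coefficients of `y t` in the frame `F t`
  let a : ℕ → V := fun t => a₀ - h • ∑ s ∈ Finset.range t, adjoint (F s) (R s (ξ s))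
  have ha : ∀ t, a (t + 1) = a t - h • adjoint (F t) (R t (ξ t)) := by
    intro t
    simp only [a, Finset.sum_range_succ, smul_add]
    abel
  have hya : ∀ t, y t = F t (a t) := by
    intro t
    induction t with
    | zero => simpa [a] using hy₀
    | succ t ih =>
      rw [ha, map_sub, map_smul, hC, hy, ih, hF.succ t]
      simp [smul_add, sub_sub]
  set X : ℕ → H := fun t => ∑ s ∈ Finset.range t, ξ s with hX
  have hXs : ∀ t, ξ t = X (t + 1) - X t := fun t => by simp [hX, Finset.sum_range_succ]
  -- summation by parts
  let b : ℕ → V := fun t => a t + h • adjoint (F t) (R t (X t))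
  have hb : ∀ t, b (t + 1) = b t + h • adjoint (F t)
      ((R (t + 1) (X (t + 1)) - X (t + 1)) - N t (R (t + 1) (X (t + 1)))
        - (R t (X (t + 1)) - X (t + 1))) := by
    intro t
    simp only [b, ha, hFs, hXs, map_sub, smul_sub]
    abel
  have hbn : ∀ t, ‖b (t + 1)‖ ≤ ‖b t‖ + 6 * h * (m / α) * (ρ t / (t + 1)) * ‖X (t + 1)‖ := by
    intro t
    rw [hb]
    refine (norm_add_le _ _).trans ?_
    gcongr
    rw [norm_smul, Real.norm_of_nonneg hh.le]
    have e1 : ‖R (t + 1) (X (t + 1)) - X (t + 1)‖ ≤ 2 * (m / α / (t + 1)) * ‖X (t + 1)‖ :=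
      (hR3 _ _).trans (by gcongr; exact hθ' t)
    have e2 : ‖R t (X (t + 1)) - X (t + 1)‖ ≤ 2 * (m / α / (t + 1)) * ‖X (t + 1)‖ :=
      (hR3 _ _).trans (by gcongr; exact hθ t)
    have e3 : ‖N t (R (t + 1) (X (t + 1)))‖ ≤ m / α / (t + 1) * (2 * ‖X (t + 1)‖) :=
      ((N t).le_of_opNorm_le ((hN t).trans (hθ t)) _).trans (by gcongr; exact hR2 _ _)
    calc _ ≤ h * (ρ t * (2 * (m / α / (t + 1)) * ‖X (t + 1)‖
          + m / α / (t + 1) * (2 * ‖X (t + 1)‖) + 2 * (m / α / (t + 1)) * ‖X (t + 1)‖)) := by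
          gcongr
          refine (hadj _ _).trans ?_
          gcongr
          · exact hρ0 t
          · exact (norm_sub_le _ _).trans
              (add_le_add ((norm_sub_le _ _).trans (add_le_add e1 e3)) e2)
      _ = _ := by ring
  have hbT : ‖b T‖ ≤ ‖a₀‖ + ∑ t ∈ Finset.range T,
      6 * h * (m / α) * (ρ t / (t + 1)) * ‖X (t + 1)‖ := by
    induction T with
    | zero => simp [b, a, hX]
    | succ T ih => rw [Finset.sum_range_succ]; linarith [hbn T]
  have haT : ‖a T‖ ≤ ‖b T‖ + 2 * h * ρ T * ‖X T‖ := by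
    calc ‖a T‖ = ‖b T - h • adjoint (F T) (R T (X T))‖ := by simp [b]
      _ ≤ ‖b T‖ + h * (ρ T * (2 * ‖X T‖)) := by
        refine (norm_sub_le _ _).trans ?_
        rw [norm_smul, Real.norm_of_nonneg hh.le]
        gcongr
        refine (hadj _ _).trans ?_
        gcongr
        · exact hρ0 T
        · exact hR2 _ _
      _ = _ := by ring
  rw [hya]
  refine ((F T).le_of_opNorm_le (hρ T) _).trans ?_
  gcongr
  · exact hρ0 T
  · linarith

end Flow

end DEKI

/-! ### The ensemble as a frame recursion, and the pathwise estimate -/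

namespace DEKI

section Ensemble

open ContinuousLinearMap

variable {J d p : ℕ}

/-- The synthesis operator `a ↦ J^(-1/2) ∑ⱼ aⱼ e⁽ʲ⁾` of the ensemble spreads, normalized so that
the sample covariance is `frame z ∘ (frame z)†`. -/
noncomputable def frame (z : Fin J → Vec d) : EuclideanSpace ℝ (Fin J) →L[ℝ] Vec d :=
  (√J)⁻¹ • ∑ j, (EuclideanSpace.proj j : EuclideanSpace ℝ (Fin J) →L[ℝ] ℝ).smulRight (spread z j)

theorem frame_apply (z : Fin J → Vec d) (a : EuclideanSpace ℝ (Fin J)) :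
    frame z a = (√J)⁻¹ • ∑ j, a j • spread z j := by
  simp [frame]

theorem adjoint_frame_apply (z : Fin J → Vec d) (v : Vec d) :
    adjoint (frame z) v = WithLp.toLp 2 fun j => (√J)⁻¹ * ⟪spread z j, v⟫ := by
  refine ext_inner_right ℝ fun a => ?_
  rw [adjoint_inner_left, frame_apply, inner_smul_right, inner_sum, PiLp.inner_apply,
    Finset.mul_sum]
  refine Finset.sum_congr rfl fun j _ => ?_
  simp only [inner_smul_right, RCLike.inner_apply, conj_trivial, real_inner_comm v]
  ring

theorem cov_apply (z : Fin J → Vec d) (v : Vec d) :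
    cov z v = frame z (adjoint (frame z) v) := by
  rw [frame_apply, adjoint_frame_apply]
  simp only [cov, smul_apply, sum_apply, InnerProductSpace.rankOne_apply, mul_smul,
    ← Finset.smul_sum]
  rw [← mul_smul, ← mul_inv, Real.mul_self_sqrt (Nat.cast_nonneg J)]

theorem spreadEnergy_nonneg (z : Fin J → Vec d) : 0 ≤ spreadEnergy z := by
  unfold spreadEnergy; positivity

theorem norm_frame_sq_le (z : Fin J → Vec d) : ‖frame z‖ ^ 2 ≤ spreadEnergy z := by
  have h : ‖frame z‖ ≤ √(spreadEnergy z) := by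
    refine opNorm_le_bound _ (Real.sqrt_nonneg _) fun a => ?_
    refine le_of_sq_le_sq ?_ (by positivity)
    rw [mul_pow, Real.sq_sqrt (spreadEnergy_nonneg z), frame_apply, norm_smul, mul_pow,
      EuclideanSpace.norm_sq_eq a, norm_inv, Real.norm_of_nonneg (Real.sqrt_nonneg _), inv_pow,
      Real.sq_sqrt (Nat.cast_nonneg J), spreadEnergy, mul_assoc]
    gcongr
    calc ‖∑ j, a j • spread z j‖ ^ 2 ≤ (∑ j, ‖spread z j‖ * ‖a j‖) ^ 2 := by
          gcongr
          refine (norm_sum_le _ _).trans (Finset.sum_le_sum fun j _ => ?_)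
          rw [norm_smul, mul_comm]
      _ ≤ _ := Finset.sum_mul_sq_le_sq_mul_sq _ _ _
  calc ‖frame z‖ ^ 2 ≤ √(spreadEnergy z) ^ 2 := by gcongr
    _ = _ := Real.sq_sqrt (spreadEnergy_nonneg z)

theorem mean_step (hJ : J ≠ 0) (α h : ℝ) (S : Vec d →L[ℝ] Vec p) (u : Vec p)
    (z : Fin J → Vec d) :
    mean (step α h S u z)
      = mean z - h • cov z (adjoint S (S (mean z) - u) + α • mean z) := by
  have hJ' : (J : ℝ) ≠ 0 := by exact_mod_cast hJ
  have hu : (J : ℝ)⁻¹ • (J : ℝ) • u = u := inv_smul_smul₀ hJ' u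
  have hm : ∑ j, z j = (J : ℝ) • mean z := by rw [mean, smul_inv_smul₀ hJ']
  have h1 : ∑ j, (adjoint S (S (z j) - u) + α • z j)
      = (J : ℝ) • (adjoint S (S (mean z) - u) + α • mean z) := by
    rw [Finset.sum_add_distrib, ← map_sum, Finset.sum_sub_distrib, ← map_sum, ← Finset.smul_sum, hm]
    simp only [map_smul, Finset.sum_const, Finset.card_univ, Fintype.card_fin,
      ← Nat.cast_smul_eq_nsmul ℝ, ← smul_sub, smul_add, smul_comm α]
  have h2 : ∑ j, step α h S u z j
      = (J : ℝ) • (mean z - h • cov z (adjoint S (S (mean z) - u) + α • mean z)) := by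
    simp only [step]
    rw [Finset.sum_sub_distrib, ← Finset.smul_sum, ← map_sum, h1, hm, map_smul, smul_comm h,
      smul_sub]
  rw [mean, h2, inv_smul_smul₀ hJ']

theorem spread_step (hJ : J ≠ 0) (α h : ℝ) (S : Vec d →L[ℝ] Vec p) (u : Vec p)
    (z : Fin J → Vec d) (j : Fin J) :
    spread (step α h S u z) j
      = spread z j - h • cov z ((normalOp S + α • (1 : Vec d →L[ℝ] Vec d)) (spread z j)) := by
  rw [spread, mean_step hJ, step, spread, normalOp]
  simp only [add_apply, smul_apply, one_apply_eq_self, comp_apply, map_sub, map_add,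
    map_smul, smul_sub, smul_add]
  abel

/-- The spreads do not see the observation: the frame evolves by the homogeneous recursion. -/
theorem frame_step (hJ : J ≠ 0) (α h : ℝ) (S : Vec d →L[ℝ] Vec p) (u : Vec p)
    (z : Fin J → Vec d) :
    frame (step α h S u z) = frame z - h • (frame z ∘L adjoint (frame z) ∘L
      (normalOp S + α • (1 : Vec d →L[ℝ] Vec d)) ∘L frame z) := by
  ext1 a
  rw [frame_apply]
  simp only [spread_step hJ]
  rw [sub_apply, smul_apply, comp_apply, comp_apply, comp_apply, ← cov_apply, frame_apply]
  simp only [map_sum, map_smul, smul_sub, Finset.sum_sub_distrib]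
  congr 1
  rw [smul_comm h, Finset.smul_sum (r := h)]
  congr 1
  exact Finset.sum_congr rfl fun j _ => smul_comm _ _ _

theorem normalOp_inner (S : Vec d →L[ℝ] Vec p) (x y : Vec d) :
    ⟪normalOp S x, y⟫ = ⟪S x, S y⟫ := by
  rw [normalOp, comp_apply, adjoint_inner_left]

theorem norm_sq_le_of_normalOp {S : Vec d →L[ℝ] Vec p} {B : ℝ} (hB : ‖normalOp S‖ ≤ B) :
    ‖S‖ ^ 2 ≤ B := by
  rw [sq, ← ContinuousLinearMap.norm_adjoint_comp_self]
  exact hB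

theorem spreadEnergy_eq_zero (hJ : J ≤ 1) (z : Fin J → Vec d) : spreadEnergy z = 0 := by
  have : J = 0 ∨ J = 1 := by omega
  rcases this with rfl | rfl
  · simp [spreadEnergy]
  · simp [spreadEnergy, spread, mean]

/-- With fewer than two particles the spread energy is `0`, whose inverse is `0`, and no positive
step size is admissible. -/
theorem two_le_of_step_le {h B : ℝ} (hh : 0 < h) {z : Fin J → Vec d}
    (hstep : h ≤ B * (spreadEnergy z)⁻¹) : 2 ≤ J := by
  by_contra! hJ
  rw [spreadEnergy_eq_zero (by omega)] at hstep
  simp at hstep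
  linarith

/-- A nondegenerate covariance makes every vector a combination of the spreads; the coefficients
are those of least norm, `(frame z)† C⁻¹ y`. -/
theorem exists_frame_eq {σ : ℝ} (hσ : 0 < σ) {z : Fin J → Vec d} (hC : CovGT (cov z) σ)
    (y : Vec d) : ∃ a, frame z a = y ∧ σ * ‖a‖ ^ 2 ≤ ‖y‖ ^ 2 := by
  have hCle : ∀ x, σ * ‖x‖ ^ 2 ≤ ⟪x, cov z x⟫ := by
    intro x
    rcases eq_or_ne x 0 with rfl | hx
    · simp
    · exact (hC x hx).le
  have hinj : Function.Injective (cov z).toLinearMap := by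
    rw [← LinearMap.ker_eq_bot, LinearMap.ker_eq_bot']
    intro x hx
    have h1 : cov z x = 0 := hx
    have h2 := hCle x
    rw [h1, inner_zero_right] at h2
    have : ‖x‖ ^ 2 = 0 := by nlinarith [sq_nonneg ‖x‖]
    simpa using this
  obtain ⟨x, hx⟩ := LinearMap.injective_iff_surjective.1 hinj y
  have hx : cov z x = y := hx
  refine ⟨adjoint (frame z) x, by rw [← cov_apply, hx], ?_⟩
  have h1 : ‖adjoint (frame z) x‖ ^ 2 = ⟪x, y⟫ := by
    rw [← real_inner_self_eq_norm_sq, adjoint_inner_left, ← cov_apply, hx]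
  have h2 := hCle x
  rw [hx] at h2
  rw [h1]
  have h3 := real_inner_le_norm x y
  rcases eq_or_ne x 0 with rfl | hx0
  · simp
  · have h4 : 0 < ‖x‖ := norm_pos_iff.2 hx0
    have h5 : σ * ‖x‖ ≤ ‖y‖ := by
      by_contra! h
      nlinarith
    nlinarith [norm_nonneg y]

/-- The forcing at step `t` of the recursion for the mean relative to the minimizer, where
`v = zopt - zstar`: fluctuation of the normal operator plus observation noise. The index is shifted,
as the step from `t` uses the data of time `t + 1`. -/
noncomputable def drive (A : Vec d →L[ℝ] Vec d) (v : Vec d) (S : ℕ → Vec d →L[ℝ] Vec p)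
    (w : ℕ → Vec p) (t : ℕ) : Vec d :=
  (normalOp (S (t + 1)) - A) v - adjoint (S (t + 1)) (w (t + 1))

/-- The step-size condition puts the ensemble in the regime of `FrameFlow`; the factor `1 / 2` in
`FrameFlow.init` comes from `1 / J` with `2 ≤ J`. -/
theorem frameFlow_ensemble {α h Amax : ℝ} (hα : 0 < α) (hh : 0 < h)
    {S : ℕ → Vec d →L[ℝ] Vec p} (hS : ∀ t, ‖normalOp (S (t + 1))‖ ≤ Amax) (u : ℕ → Vec p)
    {z₀ : Fin J → Vec d}
    (hstep : h ≤ min (α / (J * (Amax + α) ^ 2)) (J / α) * (spreadEnergy z₀)⁻¹) :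
    FrameFlow α (Amax + α) h (fun t => normalOp (S (t + 1)) + α • (1 : Vec d →L[ℝ] Vec d))
      (fun t => frame (ensemble α h S u z₀ t)) := by
  have hJ2 : 2 ≤ J := two_le_of_step_le hh hstep
  have hA0 : 0 ≤ Amax := (norm_nonneg _).trans (hS 0)
  have hE : 0 < spreadEnergy z₀ := by
    refine (spreadEnergy_nonneg z₀).lt_of_ne' fun h0 => ?_
    rw [h0] at hstep
    simp at hstep
    linarith
  have hJ : (2 : ℝ) ≤ J := by exact_mod_cast hJ2
  refine ⟨hα, by linarith, hh, fun t x y => ?_, fun t x => ?_, fun t => ?_, ?_, fun t => ?_⟩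
  · simp only [add_apply, inner_add_left, inner_add_right, normalOp_inner, smul_apply,
      one_apply_eq_self, inner_smul_left, inner_smul_right, RCLike.conj_to_real]
    rw [real_inner_comm (normalOp _ _), normalOp_inner, real_inner_comm]
  · simp only [add_apply, inner_add_right, smul_apply, one_apply_eq_self, inner_smul_right]
    rw [real_inner_comm, normalOp_inner, real_inner_self_eq_norm_sq, real_inner_self_eq_norm_sq]
    nlinarith [sq_nonneg ‖S (t + 1) x‖]
  · refine (norm_add_le _ _).trans (add_le_add (hS t) ?_)
    rw [norm_smul, Real.norm_of_nonneg hα.le]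
    exact mul_le_of_le_one_right hα.le ContinuousLinearMap.norm_id_le
  · calc h * (Amax + α) ^ 2 * ‖frame z₀‖ ^ 2
        ≤ α / (J * (Amax + α) ^ 2) * (spreadEnergy z₀)⁻¹ * (Amax + α) ^ 2 * spreadEnergy z₀ := by
          gcongr
          · exact hstep.trans (by gcongr; exact min_le_left _ _)
          · exact norm_frame_sq_le z₀
      _ = α / J := by field_simp
      _ ≤ α / 2 := by gcongr
  · exact frame_step (by omega) α h _ _ _

theorem sum_rpow_sub_one_le {s : ℝ} (hs : 0 < s) (hs1 : s ≤ 1) (T : ℕ) :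
    ∑ t ∈ Finset.range T, ((t : ℝ) + 1) ^ (s - 1) ≤ (T : ℝ) ^ s / s := by
  induction T with
  | zero => simp [Real.zero_rpow hs.ne']
  | succ T ih =>
    rw [Finset.sum_range_succ]
    have hT : (0 : ℝ) < T + 1 := by positivity
    -- Bernoulli: `(T + 1) ^ s - T ^ s` is at least `s * (T + 1) ^ (s - 1)`
    have h1 : (1 + -(1 / ((T : ℝ) + 1))) ^ s ≤ 1 + s * -(1 / ((T : ℝ) + 1)) := by
      refine rpow_one_add_le_one_add_mul_self ?_ hs.le hs1
      rw [neg_le_neg_iff, div_le_one hT]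
      linarith [(Nat.cast_nonneg T : (0 : ℝ) ≤ T)]
    have h2 : (1 + -(1 / ((T : ℝ) + 1))) = T / (T + 1) := by field_simp; ring
    rw [h2, Real.div_rpow (Nat.cast_nonneg T) hT.le, div_le_iff₀ (by positivity)] at h1
    have h3 : ((T : ℝ) + 1) ^ (s - 1) = (T + 1) ^ s / (T + 1) := by
      rw [Real.rpow_sub hT, Real.rpow_one]
    rw [h3]
    push_cast
    rw [le_div_iff₀ hs] at ih ⊢
    have h4 : (1 + s * -(1 / ((T : ℝ) + 1))) * (T + 1) ^ s
        = (T + 1) ^ s - (T + 1) ^ s / (T + 1) * s := by ring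
    rw [h4] at h1
    linarith

theorem sq_add_add_le (a b c : ℝ) : (a + b + c) ^ 2 ≤ 3 * (a ^ 2 + b ^ 2 + c ^ 2) := by
  nlinarith [sq_nonneg (a - b), sq_nonneg (b - c), sq_nonneg (a - c)]

/-- Cauchy–Schwarz for `t^(-3/2) = t^(-lam/2) * t^((lam-3)/2)`. -/
theorem sq_sum_weighted_le {lam : ℝ} (h1 : lam < 1) (h0 : 0 < lam) (x : ℕ → ℝ) (T : ℕ) :
    (∑ t ∈ Finset.range T, ((t : ℝ) + 1) ^ (-(3 / 2) : ℝ) * x t) ^ 2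
      ≤ (T : ℝ) ^ (1 - lam) / (1 - lam) *
        ∑ t ∈ Finset.range T, ((t : ℝ) + 1) ^ (lam - 3) * x t ^ 2 := by
  have hpos : ∀ t : ℕ, (0 : ℝ) < t + 1 := fun t => by positivity
  calc (∑ t ∈ Finset.range T, ((t : ℝ) + 1) ^ (-(3 / 2) : ℝ) * x t) ^ 2
      = (∑ t ∈ Finset.range T, ((t : ℝ) + 1) ^ (-(lam / 2)) *
          (((t : ℝ) + 1) ^ ((lam - 3) / 2) * x t)) ^ 2 := by
        congr 1
        refine Finset.sum_congr rfl fun t _ => ?_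
        rw [← mul_assoc, ← Real.rpow_add (hpos t)]
        congr 2
        ring
    _ ≤ (∑ t ∈ Finset.range T, (((t : ℝ) + 1) ^ (-(lam / 2))) ^ 2) *
          ∑ t ∈ Finset.range T, (((t : ℝ) + 1) ^ ((lam - 3) / 2) * x t) ^ 2 :=
        Finset.sum_mul_sq_le_sq_mul_sq _ _ _
    _ = (∑ t ∈ Finset.range T, ((t : ℝ) + 1) ^ ((1 - lam) - 1)) *
          ∑ t ∈ Finset.range T, ((t : ℝ) + 1) ^ (lam - 3) * x t ^ 2 := by
        congr 1 <;> refine Finset.sum_congr rfl fun t _ => ?_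
        · rw [← Real.rpow_mul_natCast (hpos t).le]
          congr 1
          push_cast
          ring
        · rw [mul_pow, ← Real.rpow_mul_natCast (hpos t).le]
          congr 2
          push_cast
          ring
    _ ≤ _ := by
        refine mul_le_mul_of_nonneg_right (sum_rpow_sub_one_le (by linarith) (by linarith) T) ?_
        exact Finset.sum_nonneg fun t _ => mul_nonneg (Real.rpow_nonneg (hpos t).le _) (sq_nonneg _)

/-- The pathwise estimate: the distance of the mean to the minimizer is controlled by the initial
distance and the partial sums of the forcing, with a constant that depends on the path only through
the almost sure bounds. -/
theorem exists_norm_mean_sub_zopt_sq_le {A : Vec d →L[ℝ] Vec d} (hA : 0 ≤ A) {α h Amax σ lam : ℝ}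
    (hα : 0 < α) (hh : 0 < h) (hσ : 0 < σ) (hAmax : 0 ≤ Amax) (hlam0 : 0 < lam) (hlam1 : lam < 1)
    (zstar : Vec d) :
    ∃ K, 0 ≤ K ∧ ∀ (S : ℕ → Vec d →L[ℝ] Vec p) (w : ℕ → Vec p) (z₀ : Fin J → Vec d),
      (∀ t, ‖normalOp (S (t + 1))‖ ≤ Amax) → CovGT (cov z₀) σ →
      h ≤ min (α / (J * (Amax + α) ^ 2)) (J / α) * (spreadEnergy z₀)⁻¹ →
      ∀ T : ℕ, 1 ≤ T →
        ‖mean (ensemble α h S (fun t => S t zstar + w t) z₀ T) - zopt A α zstar‖ ^ 2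
          ≤ K / T * (‖mean z₀ - zopt A α zstar‖ ^ 2
            + (T : ℝ) ^ (1 - lam) * ∑ t ∈ Finset.range T, ((t : ℝ) + 1) ^ (lam - 3) *
              ‖∑ s ∈ Finset.range (t + 1), drive A (zopt A α zstar - zstar) S w s‖ ^ 2
            + ‖∑ s ∈ Finset.range T, drive A (zopt A α zstar - zstar) S w s‖ ^ 2 / T) := by
  set k : ℝ := √((h * α)⁻¹) with hk
  have hk0 : 0 ≤ k := Real.sqrt_nonneg _
  set c₁ : ℝ := 6 * h * ((Amax + α) / α) * k with hc₁
  set c₂ : ℝ := 2 * h * k with hc₂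
  have hl : 0 < 1 - lam := by linarith
  refine ⟨3 * k ^ 2 * (σ⁻¹ + c₁ ^ 2 / (1 - lam) + c₂ ^ 2), by positivity, ?_⟩
  intro S w z₀ hS hC hstep T hT
  have hJ2 : 2 ≤ J := two_le_of_step_le hh hstep
  set v := zopt A α zstar - zstar with hv
  set u : ℕ → Vec p := fun t => S t zstar + w t with hu
  have hflow := frameFlow_ensemble hα hh hS u hstep
  obtain ⟨a₀, ha₀, ha₀n⟩ := exists_frame_eq hσ hC (mean z₀ - zopt A α zstar)
  have hy : ∀ t, mean (ensemble α h S u z₀ (t + 1)) - zopt A α zstar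
      = (mean (ensemble α h S u z₀ t) - zopt A α zstar)
        - h • frame (ensemble α h S u z₀ t) (adjoint (frame (ensemble α h S u z₀ t))
          ((normalOp (S (t + 1)) + α • (1 : Vec d →L[ℝ] Vec d))
            (mean (ensemble α h S u z₀ t) - zopt A α zstar) + drive A v S w t)) := by
    intro t
    rw [← cov_apply, ensemble, mean_step (by omega), sub_right_comm]
    congr 3
    have h1 : A (zopt A α zstar) = A zstar - α • zopt A α zstar :=
      eq_sub_of_add_eq (zopt_eq hA hα zstar)
    simp only [hu, drive, hv, normalOp, add_apply, sub_apply, smul_apply, one_apply_eq_self,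
      comp_apply, map_sub, map_add, h1]
    abel
  have hρ : ∀ t, ‖frame (ensemble α h S u z₀ t)‖ ≤ k * ((t : ℝ) + 1) ^ (-(1 / 2) : ℝ) := by
    intro t
    have hp : (0 : ℝ) < (t : ℝ) + 1 := by positivity
    refine (Real.le_sqrt_of_sq_le (hflow.norm_sq_le t)).trans_eq ?_
    rw [mul_inv, Real.sqrt_mul (by positivity), Real.rpow_neg hp.le, ← Real.sqrt_eq_rpow,
      Real.sqrt_inv ((t : ℝ) + 1)]
  have hmain := hflow.norm_le (y := fun t => mean (ensemble α h S u z₀ t) - zopt A α zstar)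
    (ξ := drive A v S w) ha₀.symm hy hρ T
  have hTp : (0 : ℝ) < T := by exact_mod_cast hT
  generalize hX : (fun t => ‖∑ s ∈ Finset.range t, drive A v S w s‖) = X at *
  have hXt : ∀ t, ‖∑ s ∈ Finset.range t, drive A v S w s‖ = X t := fun t => by rw [← hX]
  simp only [hXt] at hmain ⊢
  have hX0 : ∀ t, 0 ≤ X t := fun t => by rw [← hXt]; positivity
  set q : ℝ := (T : ℝ) ^ (-(1 / 2) : ℝ) with hq
  have hq2 : q ^ 2 = 1 / T := by
    rw [hq, ← Real.rpow_mul_natCast hTp.le]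
    norm_num [Real.rpow_neg_one]
  have hq0 : 0 ≤ q := by positivity
  have hqT : ((T : ℝ) + 1) ^ (-(1 / 2) : ℝ) ≤ q :=
    Real.rpow_le_rpow_of_nonpos hTp (by linarith) (by norm_num)
  set Q' : ℝ := ∑ t ∈ Finset.range T, ((t : ℝ) + 1) ^ (-(3 / 2) : ℝ) * X (t + 1) with hQ'
  have hsum : ∑ t ∈ Finset.range T, 6 * h * ((Amax + α) / α) *
      (k * ((t : ℝ) + 1) ^ (-(1 / 2) : ℝ) / (t + 1)) * X (t + 1) = c₁ * Q' := by
    rw [hQ', Finset.mul_sum]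
    refine Finset.sum_congr rfl fun t _ => ?_
    have hp : (0 : ℝ) < (t : ℝ) + 1 := by positivity
    have : ((t : ℝ) + 1) ^ (-(3 / 2) : ℝ) = ((t : ℝ) + 1) ^ (-(1 / 2) : ℝ) / (t + 1) := by
      rw [← Real.rpow_sub_one hp.ne']; norm_num
    rw [this, hc₁]
    ring
  rw [hsum] at hmain
  have hQ'0 : 0 ≤ Q' := Finset.sum_nonneg fun t _ =>
    mul_nonneg (Real.rpow_nonneg (by positivity) _) (hX0 _)
  have hmain' : ‖mean (ensemble α h S u z₀ T) - zopt A α zstar‖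
      ≤ k * q * (‖a₀‖ + c₁ * Q' + c₂ * q * X T) := by
    refine hmain.trans ?_
    have := hX0 T
    have : 2 * h * (k * ((T : ℝ) + 1) ^ (-(1 / 2) : ℝ)) * X T ≤ c₂ * q * X T := by
      rw [← mul_assoc (2 * h), ← hc₂]
      have : 0 ≤ c₂ := by positivity
      gcongr
    gcongr
  have hCS := sq_sum_weighted_le hlam1 hlam0 (fun t => X (t + 1)) T
  simp only [← hQ'] at hCS
  set Q : ℝ := ∑ t ∈ Finset.range T, ((t : ℝ) + 1) ^ (lam - 3) * X (t + 1) ^ 2 with hQ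
  have hQ0 : 0 ≤ Q := Finset.sum_nonneg fun t _ =>
    mul_nonneg (Real.rpow_nonneg (by positivity) _) (sq_nonneg _)
  set Y := ‖mean z₀ - zopt A α zstar‖ with hY
  have ha : ‖a₀‖ ^ 2 ≤ σ⁻¹ * Y ^ 2 := by
    rw [← div_eq_inv_mul, le_div_iff₀ hσ, mul_comm]; exact ha₀n
  have hP0 : 0 ≤ (T : ℝ) ^ (1 - lam) * Q := by positivity
  calc ‖mean (ensemble α h S u z₀ T) - zopt A α zstar‖ ^ 2
      ≤ (k * q * (‖a₀‖ + c₁ * Q' + c₂ * q * X T)) ^ 2 := by gcongr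
    _ = k ^ 2 * q ^ 2 * (‖a₀‖ + c₁ * Q' + c₂ * q * X T) ^ 2 := by ring
    _ ≤ k ^ 2 * q ^ 2 * (3 * (‖a₀‖ ^ 2 + (c₁ * Q') ^ 2 + (c₂ * q * X T) ^ 2)) :=
        mul_le_mul_of_nonneg_left (sq_add_add_le _ _ _) (by positivity)
    _ = 3 * k ^ 2 / T * (‖a₀‖ ^ 2 + c₁ ^ 2 * Q' ^ 2 + c₂ ^ 2 * (X T ^ 2 / T)) := by
        rw [mul_pow (c₂ * q), mul_pow c₂, hq2]; ring
    _ ≤ 3 * k ^ 2 / T * (σ⁻¹ * Y ^ 2 + c₁ ^ 2 * ((T : ℝ) ^ (1 - lam) / (1 - lam) * Q)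
          + c₂ ^ 2 * (X T ^ 2 / T)) := by gcongr
    _ = 3 * k ^ 2 / T * (σ⁻¹ * Y ^ 2 + c₁ ^ 2 / (1 - lam) * ((T : ℝ) ^ (1 - lam) * Q)
          + c₂ ^ 2 * (X T ^ 2 / T)) := by ring
    _ ≤ 3 * k ^ 2 / T * ((σ⁻¹ + c₁ ^ 2 / (1 - lam) + c₂ ^ 2) *
          (Y ^ 2 + (T : ℝ) ^ (1 - lam) * Q + X T ^ 2 / T)) := by
        gcongr
        have e1 : 0 ≤ σ⁻¹ := by positivity
        have e2 : 0 ≤ c₁ ^ 2 / (1 - lam) := by positivity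
        have e3 : 0 ≤ c₂ ^ 2 := by positivity
        have e4 : 0 ≤ Y ^ 2 := by positivity
        have e5 : 0 ≤ X T ^ 2 / T := by positivity
        generalize σ⁻¹ = a at *
        generalize c₁ ^ 2 / (1 - lam) = b at *
        generalize c₂ ^ 2 = c at *
        generalize (T : ℝ) ^ (1 - lam) * Q = x at *
        generalize X T ^ 2 / T = y at *
        generalize Y ^ 2 = z at *
        nlinarith [mul_nonneg e1 hP0, mul_nonneg e1 e5, mul_nonneg e2 e4, mul_nonneg e2 e5,
          mul_nonneg e3 e4, mul_nonneg e3 hP0]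
    _ = _ := by ring

end Ensemble

end DEKI

/-! ### Second moments of the accumulated forcing -/

namespace DEKI

theorem integrable_norm_sq {Ω E : Type*} {m : MeasurableSpace Ω} {P : Measure Ω}
    [NormedAddCommGroup E] {f : Ω → E} (hf : MemLp f 2 P) :
    Integrable (fun ω => ‖f ω‖ ^ 2) P := hf.norm.integrable_sq

section Correlation

variable {Ω E : Type*} {m : MeasurableSpace Ω} {P : Measure Ω}
  [NormedAddCommGroup E] [InnerProductSpace ℝ E]

theorem integrable_inner_of_memLp {f g : Ω → E} (hf : MemLp f 2 P) (hg : MemLp g 2 P) :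
    Integrable (fun ω => ⟪f ω, g ω⟫) P := by
  refine ((integrable_norm_sq hf).add (integrable_norm_sq hg)).mono'
    (hf.1.inner hg.1) (ae_of_all _ fun ω => ?_)
  have := norm_inner_le_norm (𝕜 := ℝ) (f ω) (g ω)
  simp only [Pi.add_apply]
  nlinarith [two_mul_le_add_sq ‖f ω‖ ‖g ω‖, sq_nonneg ‖f ω‖, sq_nonneg ‖g ω‖]

theorem integral_inner_le {f g : Ω → E} (hf : MemLp f 2 P) (hg : MemLp g 2 P) {D : ℝ}
    (hfD : ∫ ω, ‖f ω‖ ^ 2 ∂P ≤ D) (hgD : ∫ ω, ‖g ω‖ ^ 2 ∂P ≤ D) :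
    ∫ ω, ⟪f ω, g ω⟫ ∂P ≤ D := by
  have h1 : ∫ ω, ⟪f ω, g ω⟫ ∂P ≤ ∫ ω, (‖f ω‖ ^ 2 + ‖g ω‖ ^ 2) / 2 ∂P := by
    refine integral_mono (integrable_inner_of_memLp hf hg)
      (((integrable_norm_sq hf).add (integrable_norm_sq hg)).div_const 2) fun ω => ?_
    have := real_inner_le_norm (f ω) (g ω)
    simp only
    nlinarith [two_mul_le_add_sq ‖f ω‖ ‖g ω‖]
  rw [integral_div, integral_add (integrable_norm_sq hf) (integrable_norm_sq hg)] at h1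
  linarith

/-- Second moment of a sum whose terms are nearly uncorrelated beyond the lag `n`: of the `t²`
pairs, at most `(2n + 1) t` are within that lag. -/
theorem integral_norm_sum_sq_le {f : ℕ → Ω → E} (hf : ∀ s, MemLp (f s) 2 P) {D δ : ℝ} {n : ℕ}
    (hδ : 0 ≤ δ) (hD : ∀ s, ∫ ω, ‖f s ω‖ ^ 2 ∂P ≤ D)
    (hcor : ∀ s r, s + n < r → ∫ ω, ⟪f s ω, f r ω⟫ ∂P ≤ δ) (t : ℕ) :
    ∫ ω, ‖∑ s ∈ Finset.range t, f s ω‖ ^ 2 ∂P ≤ (2 * n + 1) * t * D + t ^ 2 * δ := by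
  have hD0 : 0 ≤ D := (integral_nonneg fun ω => sq_nonneg _).trans (hD 0)
  have hpair : ∀ s r, ∫ ω, ⟪f s ω, f r ω⟫ ∂P
      ≤ (if r ∈ Finset.Icc (s - n) (s + n) then D else 0) + δ := by
    intro s r
    split_ifs with h
    · linarith [integral_inner_le (hf s) (hf r) (hD s) (hD r)]
    · rw [zero_add]
      rw [Finset.mem_Icc] at h
      rcases lt_or_ge (s + n) r with h1 | h1
      · exact hcor s r h1
      · simp only [real_inner_comm (f r _)]
        exact hcor r s (by omega)
  calc ∫ ω, ‖∑ s ∈ Finset.range t, f s ω‖ ^ 2 ∂P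
      = ∑ s ∈ Finset.range t, ∑ r ∈ Finset.range t, ∫ ω, ⟪f s ω, f r ω⟫ ∂P := by
        simp only [← real_inner_self_eq_norm_sq, sum_inner, inner_sum]
        rw [integral_finsetSum _ fun s _ => integrable_finsetSum _ fun r _ =>
          integrable_inner_of_memLp (hf _) (hf _)]
        refine Finset.sum_congr rfl fun s _ => ?_
        rw [integral_finsetSum _ fun r _ => integrable_inner_of_memLp (hf _) (hf _)]
        simp only [real_inner_comm]
    _ ≤ ∑ s ∈ Finset.range t, ((2 * n + 1) * D + t * δ) := by
        refine Finset.sum_le_sum fun s _ => ?_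
        refine (Finset.sum_le_sum fun r _ => hpair s r).trans ?_
        rw [Finset.sum_add_distrib, ← Finset.sum_filter, Finset.sum_const, Finset.sum_const,
          Finset.card_range, nsmul_eq_mul, nsmul_eq_mul]
        gcongr
        have h1 : (Finset.filter (· ∈ Finset.Icc (s - n) (s + n)) (Finset.range t)).card
            ≤ 2 * n + 1 := by
          refine (Finset.card_le_card fun r hr => (Finset.mem_filter.1 hr).2).trans ?_
          rw [Nat.card_Icc]
          omega
        exact_mod_cast h1
    _ = _ := by
        rw [Finset.sum_const, Finset.card_range, nsmul_eq_mul]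
        ring

end Correlation

section Drive

open ContinuousLinearMap

variable {Ω : Type*} {m : MeasurableSpace Ω} {P : Measure Ω}
  {d p : ℕ} {ℱ : Filtration ℕ m} {S : ℕ → Ω → Vec d →L[ℝ] Vec p} {w : ℕ → Ω → Vec p}
  {A : Vec d →L[ℝ] Vec d} {τ : ℝ → ℕ} {Amax : ℝ}

theorem continuous_normalOp : Continuous (normalOp : (Vec d →L[ℝ] Vec p) → Vec d →L[ℝ] Vec d) :=
  (LinearIsometryEquiv.continuous adjoint).clm_comp continuous_id

theorem ErgodicData.stronglyMeasurable_normalOp (hS : ErgodicData P ℱ S A τ) (t : ℕ) :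
    StronglyMeasurable[ℱ t] fun ω => normalOp (S t ω) :=
  continuous_normalOp.comp_stronglyMeasurable (hS.adapted t).stronglyMeasurable

/-- Beyond the lag `τ ε` the fluctuations of the normal operator are correlated by `O(ε)` only:
condition on the time `r - 1 - τ ε`, at which the earlier fluctuation is known. -/
theorem ErgodicData.integral_inner_le [IsProbabilityMeasure P] (hS : ErgodicData P ℱ S A τ)
    (hAmax : ∀ t : ℕ, 1 ≤ t → ∀ᵐ ω ∂P, ‖normalOp (S t ω)‖ ≤ Amax) (v : Vec d) {ε : ℝ} (hε : 0 < ε)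
    {s r : ℕ} (hs : 1 ≤ s) (hr : s + τ ε < r) :
    ∫ ω, ⟪(normalOp (S s ω) - A) v, (normalOp (S r ω) - A) v⟫ ∂P
      ≤ (Amax + ‖A‖) * ‖v‖ * (ε * ‖v‖) := by
  obtain ⟨t, rfl⟩ : ∃ t, r = t + 1 + τ ε := ⟨r - 1 - τ ε, by omega⟩
  have hst : s ≤ t := by omega
  set f : Ω → Vec d := fun ω => (normalOp (S s ω) - A) v with hf
  have hfm : StronglyMeasurable[ℱ t] f :=
    (by fun_prop : Continuous fun N : Vec d →L[ℝ] Vec d => (N - A) v).comp_stronglyMeasurable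
      ((hS.stronglyMeasurable_normalOp s).mono (ℱ.mono hst))
  have hfb : ∀ᵐ ω ∂P, ‖f ω‖ ≤ (Amax + ‖A‖) * ‖v‖ := by
    filter_upwards [hAmax s hs] with ω hω
    exact le_of_opNorm_le _ ((norm_sub_le _ _).trans (by gcongr)) v
  have hgi : Integrable (fun ω => normalOp (S (t + 1 + τ ε) ω)) P := by
    refine Integrable.of_bound
      ((hS.stronglyMeasurable_normalOp _).mono (ℱ.le _)).aestronglyMeasurable Amax
      (hAmax _ (by omega))
  have hgi' : Integrable (fun ω => normalOp (S (t + 1 + τ ε) ω) - A) P :=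
    hgi.sub (integrable_const A)
  -- the pairing `(x, N) ↦ ⟪x, N v⟫`
  let B : Vec d →L[ℝ] (Vec d →L[ℝ] Vec d) →L[ℝ] ℝ :=
    (ContinuousLinearMap.compL ℝ (Vec d →L[ℝ] Vec d) (Vec d) ℝ).flip
      (ContinuousLinearMap.apply ℝ (Vec d) v) ∘L innerSL ℝ
  have hB : ∀ x N, B x N = ⟪x, N v⟫ := fun x N => rfl
  have hpull := condExp_aestronglyMeasurable_bilin_of_bound (μ := P) B (ℱ.le t)
    hfm.aestronglyMeasurable hgi' _ hfb
  have hcs : P[fun ω => normalOp (S (t + 1 + τ ε) ω) - A | ℱ t] =ᵐ[P]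
      fun ω => (P[fun ω => normalOp (S (t + 1 + τ ε) ω) | ℱ t]) ω - A := by
    refine (condExp_sub hgi (integrable_const A) (ℱ t)).trans ?_
    rw [condExp_const (ℱ.le t)]
    rfl
  simp only [hB] at hpull
  rw [← integral_condExp (ℱ.le t), integral_congr_ae hpull]
  have hb : ∀ᵐ ω ∂P, ‖⟪f ω, (P[fun ω => normalOp (S (t + 1 + τ ε) ω) - A | ℱ t]) ω v⟫‖
      ≤ (Amax + ‖A‖) * ‖v‖ * (ε * ‖v‖) := by
    filter_upwards [hfb, hcs, hS.mixing ε hε t (by omega)] with ω h1 h2 h3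
    rw [h2]
    refine (norm_inner_le_norm _ _).trans ?_
    gcongr
    · exact (norm_nonneg _).trans h1
    · exact le_of_opNorm_le _ h3 v
  have := norm_integral_le_of_norm_le_const hb
  rw [probReal_univ, mul_one] at this
  exact (le_abs_self _).trans this

theorem GaussianNoise.memLp {Γ : Matrix (Fin p) (Fin p) ℝ} (hw : GaussianNoise P ℱ S w Γ) (t : ℕ) :
    MemLp (w (t + 1)) 2 P := by
  have h := hw.law t
  have h1 : MemLp id 2 (P.map (w (t + 1))) := by
    rw [h.map_eq]
    exact IsGaussian.memLp_two_id
  exact h1.comp_of_map h.aemeasurable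

theorem GaussianNoise.integral_norm_sq {Γ : Matrix (Fin p) (Fin p) ℝ}
    (hw : GaussianNoise P ℱ S w Γ) (t : ℕ) :
    ∫ ω, ‖w (t + 1) ω‖ ^ 2 ∂P = ∫ x, ‖x‖ ^ 2 ∂(multivariateGaussian 0 Γ) :=
  (hw.law t).integral_comp (f := fun x => ‖x‖ ^ 2) (by fun_prop)

theorem GaussianNoise.integral_eq_zero {Γ : Matrix (Fin p) (Fin p) ℝ}
    (hw : GaussianNoise P ℱ S w Γ) (t : ℕ) : ∫ ω, w (t + 1) ω ∂P = 0 := by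
  rw [(hw.law t).integral_eq, integral_id_multivariateGaussian]

theorem norm_adjoint_apply_sq_le {S : Vec d →L[ℝ] Vec p} (hS : ‖normalOp S‖ ≤ Amax) (x : Vec p) :
    ‖adjoint S x‖ ^ 2 ≤ Amax * ‖x‖ ^ 2 := by
  have h1 : ‖adjoint S x‖ ≤ ‖S‖ * ‖x‖ := by
    rw [← LinearIsometryEquiv.norm_map adjoint S]
    exact le_opNorm _ _
  calc ‖adjoint S x‖ ^ 2 ≤ (‖S‖ * ‖x‖) ^ 2 := by gcongr
    _ = ‖S‖ ^ 2 * ‖x‖ ^ 2 := by ring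
    _ ≤ _ := by gcongr; exact norm_sq_le_of_normalOp hS

theorem continuous_adjoint_apply :
    Continuous fun q : (Vec d →L[ℝ] Vec p) × Vec p => adjoint q.1 q.2 := by
  have h : Continuous fun q : (Vec d →L[ℝ] Vec p) × Vec p => adjoint q.1 :=
    (LinearIsometryEquiv.continuous adjoint).comp continuous_fst
  exact h.clm_apply continuous_snd

theorem memLp_adjoint_apply {U : Ω → Vec d →L[ℝ] Vec p} (hU : Measurable U) {f : Ω → Vec p}
    (hf : MemLp f 2 P) (hb : ∀ᵐ ω ∂P, ‖normalOp (U ω)‖ ≤ Amax) :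
    MemLp (fun ω => adjoint (U ω) (f ω)) 2 P := by
  refine hf.of_le_mul (c := √Amax) ?_ ?_
  · exact continuous_adjoint_apply.comp_aestronglyMeasurable (f := fun ω => (U ω, f ω))
      (hU.stronglyMeasurable.aestronglyMeasurable.prodMk hf.1)
  · filter_upwards [hb] with ω hω
    have h0 : 0 ≤ Amax := (norm_nonneg _).trans hω
    refine le_of_sq_le_sq ?_ (by positivity)
    rw [mul_pow, Real.sq_sqrt h0]
    exact norm_adjoint_apply_sq_le hω _

theorem integral_norm_adjoint_apply_sq_le {U : Ω → Vec d →L[ℝ] Vec p} (hU : Measurable U)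
    {f : Ω → Vec p} (hf : MemLp f 2 P) (hb : ∀ᵐ ω ∂P, ‖normalOp (U ω)‖ ≤ Amax) :
    ∫ ω, ‖adjoint (U ω) (f ω)‖ ^ 2 ∂P ≤ Amax * ∫ ω, ‖f ω‖ ^ 2 ∂P := by
  rw [← integral_const_mul]
  refine integral_mono_ae (integrable_norm_sq (memLp_adjoint_apply hU hf hb))
    ((integrable_norm_sq hf).const_mul _) ?_
  filter_upwards [hb] with ω hω using norm_adjoint_apply_sq_le hω _

theorem memLp_clm_apply {U : Ω → Vec d →L[ℝ] Vec p} (hU : Measurable U) {f : Ω → Vec d}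
    (hf : MemLp f 2 P) (hb : ∀ᵐ ω ∂P, ‖normalOp (U ω)‖ ≤ Amax) :
    MemLp (fun ω => U ω (f ω)) 2 P := by
  refine hf.of_le_mul (c := √Amax) ?_ ?_
  · have hc : Continuous fun q : (Vec d →L[ℝ] Vec p) × Vec d => q.1 q.2 :=
      continuous_fst.clm_apply continuous_snd
    exact hc.comp_aestronglyMeasurable (hU.stronglyMeasurable.aestronglyMeasurable.prodMk hf.1)
  · filter_upwards [hb] with ω hω
    exact le_of_opNorm_le _ (Real.le_sqrt_of_sq_le (norm_sq_le_of_normalOp hω)) _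

/-- The noise terms `Sᵀ w` at different times are uncorrelated: the earlier one and both forward
operators are measurable with respect to the σ-algebra of which the later noise is independent. -/
theorem GaussianNoise.integral_inner_eq_zero [IsProbabilityMeasure P]
    {Γ : Matrix (Fin p) (Fin p) ℝ} {zstar : Vec d}
    (hw : GaussianNoise P ℱ S w Γ) (hS : ErgodicData P ℱ S A τ)
    (hu : ∀ t : ℕ, 1 ≤ t → Measurable[ℱ t] (obs S w zstar t))
    (hAmax : ∀ t : ℕ, 1 ≤ t → ∀ᵐ ω ∂P, ‖normalOp (S t ω)‖ ≤ Amax) {s r : ℕ} (hsr : s < r) :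
    ∫ ω, ⟪adjoint (S (s + 1) ω) (w (s + 1) ω), adjoint (S (r + 1) ω) (w (r + 1) ω)⟫ ∂P = 0 := by
  have hSm : ∀ t, Measurable (S t) := fun t => (hS.adapted t).mono (ℱ.le t) le_rfl
  set X : Ω → Vec p := fun ω => S (r + 1) ω (adjoint (S (s + 1) ω) (w (s + 1) ω)) with hX
  -- the noise is recovered from the observation, so it is adapted
  have hwm : Measurable[ℱ (s + 1)] (w (s + 1)) := by
    have h1 : w (s + 1) = fun ω => obs S w zstar (s + 1) ω - S (s + 1) ω zstar := by
      ext1 ω; simp [obs]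
    rw [h1]
    exact (hu (s + 1) (by omega)).sub
      ((by fun_prop : Continuous fun L : Vec d →L[ℝ] Vec p => L zstar).measurable.comp
        (hS.adapted (s + 1)))
  have hXm : Measurable[ℱ r ⊔ MeasurableSpace.comap (S (r + 1)) inferInstance] X := by
    have hle : ℱ (s + 1) ≤ ℱ r ⊔ MeasurableSpace.comap (S (r + 1)) inferInstance :=
      (ℱ.mono (by omega)).trans le_sup_left
    have h1 := hwm.mono hle le_rfl
    have h2 := (hS.adapted (s + 1)).mono hle le_rfl
    have h3 : Measurable[ℱ r ⊔ MeasurableSpace.comap (S (r + 1)) inferInstance] (S (r + 1)) :=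
      (comap_measurable (S (r + 1))).mono le_sup_right le_rfl
    have hc : Continuous fun q : (Vec d →L[ℝ] Vec p) × (Vec d →L[ℝ] Vec p) × Vec p =>
        q.1 (adjoint q.2.1 q.2.2) :=
      continuous_fst.clm_apply (continuous_adjoint_apply.comp continuous_snd)
    exact (hc.comp_stronglyMeasurable (h3.stronglyMeasurable.prodMk
      (h2.stronglyMeasurable.prodMk h1.stronglyMeasurable))).measurable
  have hind : IndepFun X (w (r + 1)) P := by
    rw [IndepFun_iff_Indep]
    exact (indep_of_indep_of_le_right (hw.indep r) hXm.comap_le).symm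
  have hXi : Integrable X P :=
    (memLp_clm_apply (hSm _) (memLp_adjoint_apply (hSm _) (hw.memLp s) (hAmax _ (by omega)))
      (hAmax _ (by omega))).integrable (by norm_num)
  have hmul := hind.integral_bilin hXi ((hw.memLp r).integrable (by norm_num)) (innerSL ℝ)
  rw [hw.integral_eq_zero, map_zero] at hmul
  rw [← hmul]
  refine integral_congr_ae (ae_of_all _ fun ω => ?_)
  change ⟪_, adjoint (S (r + 1) ω) (w (r + 1) ω)⟫ = ⟪X ω, w (r + 1) ω⟫
  rw [adjoint_inner_right]

theorem ErgodicData.memLp [IsProbabilityMeasure P] (hS : ErgodicData P ℱ S A τ)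
    (hAmax : ∀ t : ℕ, 1 ≤ t → ∀ᵐ ω ∂P, ‖normalOp (S t ω)‖ ≤ Amax) (v : Vec d) (s : ℕ) :
    MemLp (fun ω => (normalOp (S (s + 1) ω) - A) v) 2 P ∧
      ∫ ω, ‖(normalOp (S (s + 1) ω) - A) v‖ ^ 2 ∂P ≤ ((Amax + ‖A‖) * ‖v‖) ^ 2 := by
  have hb : ∀ᵐ ω ∂P, ‖(normalOp (S (s + 1) ω) - A) v‖ ≤ (Amax + ‖A‖) * ‖v‖ := by
    filter_upwards [hAmax (s + 1) (by omega)] with ω hω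
    exact le_of_opNorm_le _ ((norm_sub_le _ _).trans (by gcongr)) v
  have hm : MemLp (fun ω => (normalOp (S (s + 1) ω) - A) v) 2 P := by
    refine MemLp.of_bound ?_ _ hb
    exact (by fun_prop : Continuous fun N : Vec d →L[ℝ] Vec d =>
      (N - A) v).comp_aestronglyMeasurable
        ((hS.stronglyMeasurable_normalOp (s + 1)).mono (ℱ.le _)).aestronglyMeasurable
  refine ⟨hm, ?_⟩
  calc ∫ ω, ‖(normalOp (S (s + 1) ω) - A) v‖ ^ 2 ∂P
      ≤ ∫ _, ((Amax + ‖A‖) * ‖v‖) ^ 2 ∂P := by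
        refine integral_mono_ae (integrable_norm_sq hm) (integrable_const _) ?_
        filter_upwards [hb] with ω hω
        gcongr
    _ = _ := by simp

/-- The accumulated forcing is square-integrable, with second moment `O(τ ε * t + ε * t²)`. -/
theorem exists_integral_norm_sum_drive_sq_le [IsProbabilityMeasure P]
    {Γ : Matrix (Fin p) (Fin p) ℝ} {zstar : Vec d}
    (hw : GaussianNoise P ℱ S w Γ) (hS : ErgodicData P ℱ S A τ)
    (hu : ∀ t : ℕ, 1 ≤ t → Measurable[ℱ t] (obs S w zstar t)) (hA0 : 0 ≤ Amax)
    (hAmax : ∀ t : ℕ, 1 ≤ t → ∀ᵐ ω ∂P, ‖normalOp (S t ω)‖ ≤ Amax) (v : Vec d) :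
    (∀ t, MemLp (fun ω => ∑ s ∈ Finset.range t,
        drive A v (fun k => S k ω) (fun k => w k ω) s) 2 P) ∧
      ∃ B, 0 ≤ B ∧ ∀ ε : ℝ, 0 < ε → ∀ t : ℕ,
        ∫ ω, ‖∑ s ∈ Finset.range t, drive A v (fun k => S k ω) (fun k => w k ω) s‖ ^ 2 ∂P
          ≤ B * (τ ε * t + ε * t ^ 2) := by
  have hSm : ∀ t, Measurable (S t) := fun t => (hS.adapted t).mono (ℱ.le t) le_rfl
  set f : ℕ → Ω → Vec d := fun s ω => (normalOp (S (s + 1) ω) - A) v with hf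
  set g : ℕ → Ω → Vec d := fun s ω => adjoint (S (s + 1) ω) (w (s + 1) ω) with hg
  have hfm : ∀ s, MemLp (f s) 2 P := fun s => (hS.memLp hAmax v s).1
  have hgm : ∀ s, MemLp (g s) 2 P := fun s =>
    memLp_adjoint_apply (hSm _) (hw.memLp s) (hAmax _ (by omega))
  have hsum : ∀ t ω, ∑ s ∈ Finset.range t, drive A v (fun k => S k ω) (fun k => w k ω) s
      = ∑ s ∈ Finset.range t, f s ω - ∑ s ∈ Finset.range t, g s ω := fun t ω => by
    rw [← Finset.sum_sub_distrib]; rfl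
  have hFm : ∀ t, MemLp (fun ω => ∑ s ∈ Finset.range t, f s ω) 2 P :=
    fun t => memLp_finsetSum _ fun s _ => hfm s
  have hGm : ∀ t, MemLp (fun ω => ∑ s ∈ Finset.range t, g s ω) 2 P :=
    fun t => memLp_finsetSum _ fun s _ => hgm s
  simp only [hsum]
  refine ⟨fun t => (hFm t).sub (hGm t), ?_⟩
  set b : ℝ := (Amax + ‖A‖) * ‖v‖ with hb
  have hb0 : 0 ≤ b := by positivity
  set W : ℝ := Amax * ∫ x, ‖x‖ ^ 2 ∂(multivariateGaussian 0 Γ) with hW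
  have hW0 : 0 ≤ W := mul_nonneg hA0 (integral_nonneg fun x => sq_nonneg _)
  refine ⟨2 * (3 * b ^ 2 + b * ‖v‖ + W), by positivity, fun ε hε t => ?_⟩
  have hF := integral_norm_sum_sq_le hfm (D := b ^ 2) (δ := b * (ε * ‖v‖)) (n := τ ε)
    (by positivity) (fun s => (hS.memLp hAmax v s).2)
    (fun s r hsr => hS.integral_inner_le hAmax v hε (by omega) (by omega)) t
  have hG := integral_norm_sum_sq_le hgm (D := W) (δ := 0) (n := 0) le_rfl
    (fun s => (integral_norm_adjoint_apply_sq_le (hSm _) (hw.memLp s)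
      (hAmax _ (by omega))).trans_eq (by rw [hw.integral_norm_sq s]))
    (fun s r hsr => (hw.integral_inner_eq_zero hS hu hAmax (by omega)).le) t
  have hτ : (1 : ℝ) ≤ τ ε := by exact_mod_cast hS.tau_pos ε hε
  have hFG : ∫ ω, ‖∑ s ∈ Finset.range t, f s ω - ∑ s ∈ Finset.range t, g s ω‖ ^ 2 ∂P
      ≤ 2 * ∫ ω, ‖∑ s ∈ Finset.range t, f s ω‖ ^ 2 ∂P
        + 2 * ∫ ω, ‖∑ s ∈ Finset.range t, g s ω‖ ^ 2 ∂P := by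
    rw [← integral_const_mul, ← integral_const_mul, ← integral_add
      ((integrable_norm_sq (hFm t)).const_mul 2) ((integrable_norm_sq (hGm t)).const_mul 2)]
    refine integral_mono (integrable_norm_sq ((hFm t).sub (hGm t)))
      (((integrable_norm_sq (hFm t)).const_mul 2).add ((integrable_norm_sq (hGm t)).const_mul 2))
      fun ω => ?_
    have h1 := norm_sub_le (∑ s ∈ Finset.range t, f s ω) (∑ s ∈ Finset.range t, g s ω)
    have h2 := norm_nonneg (∑ s ∈ Finset.range t, f s ω - ∑ s ∈ Finset.range t, g s ω)
    simp only
    nlinarith [sq_nonneg (‖∑ s ∈ Finset.range t, f s ω‖ - ‖∑ s ∈ Finset.range t, g s ω‖)]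
  refine hFG.trans ?_
  have ht : (0 : ℝ) ≤ t := Nat.cast_nonneg t
  have e1 : (2 * (τ ε : ℝ) + 1) * t * b ^ 2 ≤ 3 * b ^ 2 * (τ ε * t) := by
    nlinarith [mul_nonneg (mul_nonneg (sub_nonneg.2 hτ) ht) (sq_nonneg b)]
  have e2 : (t : ℝ) * W ≤ W * (τ ε * t) := by
    nlinarith [mul_nonneg (mul_nonneg (sub_nonneg.2 hτ) ht) hW0]
  have e3 : 0 ≤ (3 * b ^ 2 + W) * (ε * t ^ 2) := by positivity
  have e4 : 0 ≤ b * ‖v‖ * (τ ε * t) := by positivity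
  push_cast at hG
  nlinarith

end Drive

end DEKI

/-! ### Measurability, expected excess loss and rates -/

namespace DEKI

section Measurability

variable {J d p : ℕ}

theorem continuous_mean : Continuous (mean : (Fin J → Vec d) → Vec d) := by
  unfold mean; fun_prop

theorem continuous_cov_apply :
    Continuous fun q : (Fin J → Vec d) × Vec d => cov q.1 q.2 := by
  have h : ∀ j : Fin J, Continuous fun q : (Fin J → Vec d) × Vec d => spread q.1 j := fun j => by
    have := continuous_mean (J := J) (d := d)
    unfold spread
    fun_prop
  simp only [cov, smul_apply, sum_apply, InnerProductSpace.rankOne_apply]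
  fun_prop

theorem continuous_step (α h : ℝ) :
    Continuous fun q : (Vec d →L[ℝ] Vec p) × Vec p × (Fin J → Vec d) =>
      step α h q.1 q.2.1 q.2.2 := by
  refine continuous_pi fun j => ?_
  have h1 : Continuous fun q : (Vec d →L[ℝ] Vec p) × Vec p × (Fin J → Vec d) => q.2.2 j := by
    fun_prop
  have h2 : Continuous fun q : (Vec d →L[ℝ] Vec p) × Vec p × (Fin J → Vec d) => q.1 (q.2.2 j) :=
    continuous_fst.clm_apply h1
  have h3 : Continuous fun q : (Vec d →L[ℝ] Vec p) × Vec p × (Fin J → Vec d) =>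
      ContinuousLinearMap.adjoint q.1 (q.1 (q.2.2 j) - q.2.1) :=
    continuous_adjoint_apply.comp
      (f := fun q : (Vec d →L[ℝ] Vec p) × Vec p × (Fin J → Vec d) => (q.1, q.1 (q.2.2 j) - q.2.1))
      (continuous_fst.prodMk (h2.sub (continuous_fst.comp continuous_snd)))
  have h4 : Continuous fun q : (Vec d →L[ℝ] Vec p) × Vec p × (Fin J → Vec d) =>
      cov q.2.2 (ContinuousLinearMap.adjoint q.1 (q.1 (q.2.2 j) - q.2.1) + α • q.2.2 j) :=
    continuous_cov_apply.comp
      (f := fun q : (Vec d →L[ℝ] Vec p) × Vec p × (Fin J → Vec d) =>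
        (q.2.2, ContinuousLinearMap.adjoint q.1 (q.1 (q.2.2 j) - q.2.1) + α • q.2.2 j))
      ((continuous_snd.comp continuous_snd).prodMk (h3.add (h1.const_smul α)))
  exact h1.sub (h4.const_smul h)

theorem continuous_loss (A : Vec d →L[ℝ] Vec d) (α : ℝ) (zstar : Vec d) :
    Continuous (loss A α zstar) := by
  unfold loss; fun_prop

theorem aestronglyMeasurable_process {Ω : Type*} {m : MeasurableSpace Ω} {P : Measure Ω}
    (α h : ℝ) {S : ℕ → Ω → Vec d →L[ℝ] Vec p} {w : ℕ → Ω → Vec p} (zstar : Vec d)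
    {z₀ : Ω → Fin J → Vec d} (hS : ∀ t, AEStronglyMeasurable (S t) P)
    (hw : ∀ t, AEStronglyMeasurable (w (t + 1)) P) (hz₀ : AEStronglyMeasurable z₀ P) (T : ℕ) :
    AEStronglyMeasurable (process α h S w zstar z₀ T) P := by
  induction T with
  | zero => exact hz₀
  | succ T ih =>
    have h1 : AEStronglyMeasurable (obs S w zstar (T + 1)) P :=
      ((by fun_prop : Continuous fun L : Vec d →L[ℝ] Vec p => L zstar).comp_aestronglyMeasurable
        (hS (T + 1))).add (hw T)
    exact (continuous_step α h).comp_aestronglyMeasurable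
      (f := fun ω => (S (T + 1) ω, obs S w zstar (T + 1) ω, process α h S w zstar z₀ T ω))
      ((hS (T + 1)).prodMk (h1.prodMk ih))

end Measurability

theorem loss_sub_loss_zopt_le {d : ℕ} {A : Vec d →L[ℝ] Vec d} {α : ℝ} (hA : 0 ≤ A) (hα : 0 < α)
    (zstar z : Vec d) :
    loss A α zstar z - loss A α zstar (zopt A α zstar)
      ≤ (‖A‖ + α) / 2 * ‖z - zopt A α zstar‖ ^ 2 := by
  have hpos := (ContinuousLinearMap.nonneg_iff_isPositive A).1 hA
  have h0 := zopt_eq hA hα zstar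
  generalize zopt A α zstar = y at h0 ⊢
  obtain ⟨x, rfl⟩ : ∃ x, z = y + x := ⟨z - y, by abel⟩
  have hs : ⟪x, A (y - zstar)⟫ + α * ⟪x, y⟫ = 0 := by
    have h1 : A (y - zstar) + α • y = 0 := by rw [map_sub, ← h0]; abel
    have h2 := congrArg (fun v => ⟪x, v⟫) h1
    simpa [inner_add_right, inner_smul_right] using h2
  have hsym : ⟪y - zstar, A x⟫ = ⟪x, A (y - zstar)⟫ := by
    rw [real_inner_comm]; exact hpos.isSymmetric x (y - zstar)
  have hx : ⟪x, A x⟫ ≤ ‖A‖ * ‖x‖ ^ 2 := by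
    have h1 := real_inner_le_norm x (A x)
    have h2 := mul_le_mul_of_nonneg_left (A.le_opNorm x) (norm_nonneg x)
    nlinarith
  have e1 : y + x - zstar = (y - zstar) + x := by abel
  have e2 : ‖y + x‖ ^ 2 = ‖y‖ ^ 2 + 2 * ⟪x, y⟫ + ‖x‖ ^ 2 := by
    rw [norm_add_sq_real, real_inner_comm]
  have e3 : y + x - y = x := by abel
  unfold loss
  rw [e1, e2, e3, map_add, inner_add_left, inner_add_right, inner_add_right, hsym]
  nlinarith

/-- The weights `t^(lam-3)` are summable against `t`, while against `t²` they sum to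
`O(T^lam)`. -/
theorem exists_sum_weighted_le {lam : ℝ} (h0 : 0 < lam) (h1 : lam < 1) :
    ∃ Z, 0 ≤ Z ∧ ∀ (a e : ℝ) (T : ℕ), 0 ≤ a → 0 ≤ e →
      ∑ t ∈ Finset.range T, ((t : ℝ) + 1) ^ (lam - 3) * (a * (t + 1) + e * (t + 1) ^ 2)
        ≤ a * Z + e * ((T : ℝ) ^ lam / lam) := by
  have hs : Summable fun t : ℕ => ((t : ℝ) + 1) ^ (lam - 2) := by
    have := (summable_nat_add_iff 1).2 (Real.summable_nat_rpow (p := lam - 2).2 (by linarith))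
    simpa using this
  refine ⟨∑' t : ℕ, ((t : ℝ) + 1) ^ (lam - 2), tsum_nonneg fun t => by positivity, ?_⟩
  intro a e T ha he
  have hterm : ∀ t : ℕ, ((t : ℝ) + 1) ^ (lam - 3) * (a * (t + 1) + e * (t + 1) ^ 2)
      = a * ((t : ℝ) + 1) ^ (lam - 2) + e * ((t : ℝ) + 1) ^ (lam - 1) := by
    intro t
    have hp : (0 : ℝ) < (t : ℝ) + 1 := by positivity
    have e1 : ((t : ℝ) + 1) ^ (lam - 2) = ((t : ℝ) + 1) ^ (lam - 3) * (t + 1) := by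
      rw [← Real.rpow_add_one hp.ne']; congr 1; ring
    have e2 : ((t : ℝ) + 1) ^ (lam - 1) = ((t : ℝ) + 1) ^ (lam - 3) * (t + 1) ^ 2 := by
      rw [← Real.rpow_add_natCast hp.ne']; congr 1; push_cast; ring
    rw [e1, e2]; ring
  simp only [hterm]
  rw [Finset.sum_add_distrib, ← Finset.mul_sum, ← Finset.mul_sum]
  gcongr
  · exact hs.sum_le_tsum _ fun t _ => by positivity
  · exact sum_rpow_sub_one_le h0 h1.le T

/-- The second-moment bounds inserted into the pathwise estimate give the rate; the factor
`T^(1-lam) * T^lam / T` in front of `ε` is `1`. -/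
theorem rate_le {K Y B Z lam ε τ : ℝ} (hK : 0 ≤ K) (hY : 0 ≤ Y) (hB : 0 ≤ B) (hZ : 0 ≤ Z)
    (h0 : 0 < lam) (h1 : lam < 1) (hε : 0 ≤ ε) (hτ : 0 ≤ τ) {T : ℕ} (hT : 1 ≤ T) :
    K / T * (Y + (T : ℝ) ^ (1 - lam) * (B * (τ * Z + ε * ((T : ℝ) ^ lam / lam)))
        + B * (τ * T + ε * T ^ 2) / T)
      ≤ K * (Y + B * Z + B / lam + B) * (ε + (1 + τ) / (T : ℝ) ^ lam) := by
  have hTp : (0 : ℝ) < T := by exact_mod_cast hT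
  have hT1 : (1 : ℝ) ≤ T := by exact_mod_cast hT
  have hD : (T : ℝ) ^ (1 - lam) = T / (T : ℝ) ^ lam := by rw [Real.rpow_sub hTp, Real.rpow_one]
  have hDT : (T : ℝ) ^ lam ≤ T := by
    simpa using Real.rpow_le_rpow_of_exponent_le hT1 h1.le
  have hDp : 0 < (T : ℝ) ^ lam := by positivity
  rw [hD]
  generalize (T : ℝ) ^ lam = D at *
  have hinv : 1 / (T : ℝ) ≤ 1 / D := by gcongr
  have e : K / T * (Y + T / D * (B * (τ * Z + ε * (D / lam))) + B * (τ * T + ε * T ^ 2) / T)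
      = K * (Y * (1 / T) + B * Z * (τ * (1 / D)) + B / lam * ε + B * (τ * (1 / T) + ε)) := by
    field_simp
    ring
  rw [e, mul_assoc K]
  refine mul_le_mul_of_nonneg_left ?_ hK
  have hq : 0 ≤ 1 / D := by positivity
  set X := ε + (1 + τ) / D with hX
  have hX' : X = ε + 1 / D + τ * (1 / D) := by rw [hX]; ring
  have hτD : 0 ≤ τ * (1 / D) := by positivity
  have a1 : 1 / (T : ℝ) ≤ X := by linarith
  have a2 : τ * (1 / D) ≤ X := by linarith
  have a3 : ε ≤ X := by linarith
  have a4 : τ * (1 / T) + ε ≤ X := by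
    have := mul_le_mul_of_nonneg_left hinv hτ
    linarith
  have hBl : 0 ≤ B / lam := by positivity
  calc Y * (1 / T) + B * Z * (τ * (1 / D)) + B / lam * ε + B * (τ * (1 / T) + ε)
      ≤ Y * X + B * Z * X + B / lam * X + B * X := by gcongr
    _ = _ := by ring

/-- The expected excess loss bound without logarithms, for any exponent in `(0, 1)`: the frame
decays at the full rate `1/T`, and the loss from `T` to `T^lam` absorbs the logarithms from
summing `1/t`. -/
theorem exists_integral_excess_le {Ω : Type*} {m : MeasurableSpace Ω} {P : Measure Ω}
    [IsProbabilityMeasure P] {J d p : ℕ} {ℱ : Filtration ℕ m}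
    {S : ℕ → Ω → Vec d →L[ℝ] Vec p} {w : ℕ → Ω → Vec p} {Γ : Matrix (Fin p) (Fin p) ℝ}
    {zstar : Vec d} (hw : GaussianNoise P ℱ S w Γ)
    (hu : ∀ t : ℕ, 1 ≤ t → Measurable[ℱ t] (obs S w zstar t))
    {A : Vec d →L[ℝ] Vec d} {τ : ℝ → ℕ} (hS : ErgodicData P ℱ S A τ)
    {Amax : ℝ} (hAmax : ∀ t : ℕ, 1 ≤ t → ∀ᵐ ω ∂P, ‖normalOp (S t ω)‖ ≤ Amax)
    {z₀ : Ω → Fin J → Vec d} (hz₀ : ∀ j, MemLp (fun ω => z₀ ω j) 2 P)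
    {α σ h lam : ℝ} (hα : 0 < α) (hσ : 0 < σ) (hh : 0 < h)
    (hC₀ : ∀ᵐ ω ∂P, CovGT (cov (z₀ ω)) σ) (hlam0 : 0 < lam) (hlam1 : lam < 1)
    (hstep : ∀ᵐ ω ∂P,
      h ≤ min (α / (J * (Amax + α) ^ 2)) (J / α) * (spreadEnergy (z₀ ω))⁻¹) :
    (∀ T, Integrable (fun ω => loss A α zstar (mean (process α h S w zstar z₀ T ω)) -
        loss A α zstar (zopt A α zstar)) P) ∧
    ∃ K, 0 ≤ K ∧ ∀ ε : ℝ, 0 < ε → ∀ T : ℕ, 1 ≤ T →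
      ∫ ω, (loss A α zstar (mean (process α h S w zstar z₀ T ω)) -
          loss A α zstar (zopt A α zstar)) ∂P
        ≤ K * (ε + (1 + τ ε) / (T : ℝ) ^ lam) := by
  have hA := hS.nonneg
  have hA0 : 0 ≤ Amax := by
    obtain ⟨ω, hω⟩ := (hAmax 1 le_rfl).exists
    exact (norm_nonneg _).trans hω
  set v := zopt A α zstar - zstar with hv
  set y : ℕ → Ω → Vec d := fun T ω =>
    mean (process α h S w zstar z₀ T ω) - zopt A α zstar with hy
  set X : ℕ → Ω → Vec d := fun t ω =>
    ∑ s ∈ Finset.range t, drive A v (fun k => S k ω) (fun k => w k ω) s with hX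
  obtain ⟨hXm, B, hB0, hB⟩ := exists_integral_norm_sum_drive_sq_le hw hS hu hA0 hAmax v
  obtain ⟨K₁, hK₁0, hK₁⟩ := exists_norm_mean_sub_zopt_sq_le (J := J) (p := p) hA hα hh hσ hA0
    hlam0 hlam1 zstar
  obtain ⟨Z, hZ0, hZ⟩ := exists_sum_weighted_le hlam0 hlam1
  set c : ℝ := (‖A‖ + α) / 2 with hc
  have hc0 : 0 ≤ c := by positivity
  have hz₀m : AEStronglyMeasurable z₀ P :=
    (aemeasurable_pi_lambda _ fun j => (hz₀ j).1.aemeasurable).aestronglyMeasurable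
  have hmeas : ∀ T, AEStronglyMeasurable (fun ω =>
      loss A α zstar (mean (process α h S w zstar z₀ T ω)) - loss A α zstar (zopt A α zstar)) P :=
    fun T => ((continuous_loss A α zstar).comp continuous_mean).comp_aestronglyMeasurable
      (aestronglyMeasurable_process α h zstar
        (fun t => ((hS.adapted t).mono (ℱ.le t) le_rfl).aestronglyMeasurable)
        (fun t => (hw.memLp t).1) hz₀m T) |>.sub aestronglyMeasurable_const
  have hle : ∀ T ω, loss A α zstar (mean (process α h S w zstar z₀ T ω)) -
      loss A α zstar (zopt A α zstar) ≤ c * ‖y T ω‖ ^ 2 :=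
    fun T ω => loss_sub_loss_zopt_le hA hα zstar _
  have hnonneg : ∀ T ω, 0 ≤ loss A α zstar (mean (process α h S w zstar z₀ T ω)) -
      loss A α zstar (zopt A α zstar) :=
    fun T ω => sub_nonneg.2 (loss_zopt_le hA hα zstar _)
  have hy0 : MemLp (y 0) 2 P :=
    ((memLp_finsetSum _ fun j _ => hz₀ j).const_smul (J : ℝ)⁻¹).sub (memLp_const _)
  have hX2 : ∀ t, Integrable (fun ω => ‖X t ω‖ ^ 2) P := fun t => integrable_norm_sq (hXm t)
  set D : ℕ → Ω → ℝ := fun T ω => K₁ / T * (‖y 0 ω‖ ^ 2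
    + (T : ℝ) ^ (1 - lam) * ∑ t ∈ Finset.range T, ((t : ℝ) + 1) ^ (lam - 3) * ‖X (t + 1) ω‖ ^ 2
    + ‖X T ω‖ ^ 2 / T) with hD
  have hsumi : ∀ T : ℕ, Integrable (fun ω =>
      ∑ t ∈ Finset.range T, ((t : ℝ) + 1) ^ (lam - 3) * ‖X (t + 1) ω‖ ^ 2) P :=
    fun T => integrable_finsetSum _ fun t _ => (hX2 _).const_mul _
  have hDi : ∀ T, Integrable (D T) P := fun T =>
    (((integrable_norm_sq hy0).add ((hsumi T).const_mul _)).add ((hX2 T).div_const _)).const_mul _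
  have hyD : ∀ T : ℕ, 1 ≤ T → ∀ᵐ ω ∂P, ‖y T ω‖ ^ 2 ≤ D T ω := by
    intro T hT
    have hall : ∀ᵐ ω ∂P, ∀ t, ‖normalOp (S (t + 1) ω)‖ ≤ Amax :=
      ae_all_iff.2 fun t => hAmax (t + 1) (by omega)
    filter_upwards [hall, hC₀, hstep] with ω h1 h2 h3
    exact hK₁ (fun k => S k ω) (fun k => w k ω) (z₀ ω) h1 h2 h3 T hT
  have hDint : ∀ ε : ℝ, 0 < ε → ∀ T : ℕ, 1 ≤ T → ∫ ω, D T ω ∂P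
      ≤ K₁ * (∫ ω, ‖y 0 ω‖ ^ 2 ∂P + B * Z + B / lam + B) * (ε + (1 + τ ε) / (T : ℝ) ^ lam) := by
    intro ε hε T hT
    refine le_trans ?_ (rate_le hK₁0 (integral_nonneg fun ω => sq_nonneg _) hB0 hZ0 hlam0 hlam1
      hε.le (Nat.cast_nonneg _) hT)
    have e1 : ∫ ω, D T ω ∂P = K₁ / T * (∫ ω, ‖y 0 ω‖ ^ 2 ∂P
        + (T : ℝ) ^ (1 - lam) *
          ∑ t ∈ Finset.range T, ((t : ℝ) + 1) ^ (lam - 3) * ∫ ω, ‖X (t + 1) ω‖ ^ 2 ∂P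
        + (∫ ω, ‖X T ω‖ ^ 2 ∂P) / T) := by
      have hi : Integrable (fun ω => ‖y 0 ω‖ ^ 2 + (T : ℝ) ^ (1 - lam) *
          ∑ t ∈ Finset.range T, ((t : ℝ) + 1) ^ (lam - 3) * ‖X (t + 1) ω‖ ^ 2) P :=
        (integrable_norm_sq hy0).add ((hsumi T).const_mul _)
      simp only [hD]
      rw [integral_const_mul, integral_add hi ((hX2 T).div_const _),
        integral_add (integrable_norm_sq hy0) ((hsumi T).const_mul _),
        integral_const_mul, integral_div, integral_finsetSum _ fun t _ => (hX2 _).const_mul _]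
      simp only [integral_const_mul]
    rw [e1]
    gcongr
    · calc ∑ t ∈ Finset.range T, ((t : ℝ) + 1) ^ (lam - 3) * ∫ ω, ‖X (t + 1) ω‖ ^ 2 ∂P
          ≤ ∑ t ∈ Finset.range T, B *
            (((t : ℝ) + 1) ^ (lam - 3) * (τ ε * (t + 1) + ε * (t + 1) ^ 2)) := by
            refine Finset.sum_le_sum fun t _ => ?_
            rw [mul_left_comm B]
            gcongr
            simpa using hB ε hε (t + 1)
        _ ≤ _ := by
            rw [← Finset.mul_sum]
            gcongr
            exact hZ _ _ T (Nat.cast_nonneg _) hε.le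
    · exact hB ε hε T
  refine ⟨fun T => ?_, c * (K₁ * (∫ ω, ‖y 0 ω‖ ^ 2 ∂P + B * Z + B / lam + B)), ?_, ?_⟩
  · rcases Nat.eq_zero_or_pos T with rfl | hT
    · refine ((integrable_norm_sq hy0).const_mul c).mono' (hmeas 0) (ae_of_all _ fun ω => ?_)
      rw [Real.norm_of_nonneg (hnonneg _ _)]
      exact hle 0 ω
    · refine ((hDi T).const_mul c).mono' (hmeas T) ?_
      filter_upwards [hyD T hT] with ω hω
      rw [Real.norm_of_nonneg (hnonneg _ _)]
      exact (hle T ω).trans (by gcongr)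
  · have : 0 ≤ ∫ ω, ‖y 0 ω‖ ^ 2 ∂P := integral_nonneg fun ω => sq_nonneg _
    positivity
  · intro ε hε T hT
    calc _ ≤ ∫ ω, c * D T ω ∂P := by
          refine integral_mono_of_nonneg (ae_of_all _ (hnonneg T)) ((hDi T).const_mul c) ?_
          filter_upwards [hyD T hT] with ω hω
          exact (hle T ω).trans (by gcongr)
      _ ≤ _ := by
          rw [integral_const_mul, mul_assoc c]
          gcongr
          exact hDint ε hε T hT

theorem isBigO_of_le_rate {e : ℕ → ℝ} {τ : ℝ → ℕ} {K lam : ℝ} (hK : 0 ≤ K) (hlam1 : lam < 1)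
    (he0 : ∀ T, 0 ≤ e T)
    (he : ∀ ε : ℝ, 0 < ε → ∀ T : ℕ, 1 ≤ T → e T ≤ K * (ε + (1 + τ ε) / (T : ℝ) ^ lam))
    (hτ : (fun T : ℕ => (τ (1 / (T : ℝ)) : ℝ)) =O[atTop] fun T : ℕ => Real.log T) :
    e =O[atTop] fun T : ℕ => Real.log T ^ 2 / (T : ℝ) ^ lam := by
  obtain ⟨C, hC⟩ := hτ.bound
  have hlog : ∀ᶠ T : ℕ in atTop, 1 ≤ Real.log T :=
    (Real.tendsto_log_atTop.comp tendsto_natCast_atTop_atTop).eventually_ge_atTop 1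
  refine IsBigO.of_bound (K * (2 + |C|)) ?_
  filter_upwards [hC, hlog, eventually_ge_atTop 1] with T hCT hl hT
  have hT1 : (1 : ℝ) ≤ T := by exact_mod_cast hT
  have hTp : (0 : ℝ) < T := by linarith
  have hDT : (T : ℝ) ^ lam ≤ T := by
    simpa using Real.rpow_le_rpow_of_exponent_le hT1 hlam1.le
  have hDp : 0 < (T : ℝ) ^ lam := by positivity
  rw [Real.norm_of_nonneg (he0 T), Real.norm_of_nonneg (by positivity)]
  rw [Real.norm_of_nonneg (Nat.cast_nonneg _), Real.norm_of_nonneg (by linarith)] at hCT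
  have hτ2 : (τ (1 / (T : ℝ)) : ℝ) ≤ |C| * Real.log T ^ 2 := by
    refine hCT.trans ?_
    gcongr
    · exact le_abs_self C
    · nlinarith
  have hl2 : 1 ≤ Real.log T ^ 2 := by nlinarith
  calc e T ≤ K * (1 / T + (1 + τ (1 / (T : ℝ))) / (T : ℝ) ^ lam) := he _ (by positivity) T hT
    _ ≤ K * (1 / (T : ℝ) ^ lam + (1 + τ (1 / (T : ℝ))) / (T : ℝ) ^ lam) := by gcongr
    _ = K * ((2 + τ (1 / (T : ℝ))) / (T : ℝ) ^ lam) := by ring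
    _ ≤ K * ((2 * Real.log T ^ 2 + |C| * Real.log T ^ 2) / (T : ℝ) ^ lam) := by
        gcongr
        linarith
    _ = _ := by ring

end DEKI

theorem theorem1 {Ω : Type*} {m : MeasurableSpace Ω} (P : Measure Ω) [IsProbabilityMeasure P]
    {J d p : ℕ} (ℱ : Filtration ℕ m)
    -- observation model `u_t = S_t z⋆ + w_t`, with `u_t` observed at time `t`
    (S : ℕ → Ω → DEKI.Vec d →L[ℝ] DEKI.Vec p) (w : ℕ → Ω → DEKI.Vec p)
    (Γ : Matrix (Fin p) (Fin p) ℝ) (hΓ : Γ.PosDef) (zstar : DEKI.Vec d)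
    (hw : DEKI.GaussianNoise P ℱ S w Γ)
    (hu : ∀ t : ℕ, 1 ≤ t → Measurable[ℱ t] (DEKI.obs S w zstar t))
    -- ergodic data, with `A_max` an almost sure bound for `‖S_tᵀ S_t‖`
    (A : DEKI.Vec d →L[ℝ] DEKI.Vec d) (τ : ℝ → ℕ) (hS : DEKI.ErgodicData P ℱ S A τ)
    (Amax : ℝ) (hAmax : ∀ t : ℕ, 1 ≤ t → ∀ᵐ ω ∂P, ‖DEKI.normalOp (S t ω)‖ ≤ Amax)
    -- the (random) initial ensemble
    (z₀ : Ω → Fin J → DEKI.Vec d) (hz₀ : ∀ j, MemLp (fun ω => z₀ ω j) 2 P)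
    (α σ h : ℝ) (hα : 0 < α) (hσ : 0 < σ) (hh : 0 < h)
    (hC₀ : ∀ᵐ ω ∂P, DEKI.CovGT (DEKI.cov (z₀ ω)) σ)
    (hlam : 2 * α * σ < 1)
    (hstep : ∀ᵐ ω ∂P,
      h ≤ min (α / (J * (Amax + α) ^ 2)) (J / α) * (DEKI.spreadEnergy (z₀ ω))⁻¹) :
    let excess : ℕ → Ω → ℝ := fun T ω =>
      DEKI.loss A α zstar (DEKI.mean (DEKI.process α h S w zstar z₀ T ω)) -
        DEKI.loss A α zstar (DEKI.zopt A α zstar)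
    (∀ T, Integrable (excess T) P) ∧
    (∃ K : ℝ, ∀ ε : ℝ, 0 < ε → ∀ T : ℕ, 1 ≤ T →
      ∫ ω, excess T ω ∂P ≤
        K * (ε + (1 + τ ε * (1 + Real.log (τ ε) + Real.log T)) / (T : ℝ) ^ (2 * α * σ))) ∧
    ((fun T : ℕ => (τ (1 / (T : ℝ)) : ℝ)) =O[atTop] (fun T : ℕ => Real.log T) →
      (fun T : ℕ => ∫ ω, excess T ω ∂P) =O[atTop]
        (fun T : ℕ => Real.log T ^ 2 / (T : ℝ) ^ (2 * α * σ))) := by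
  intro excess
  have hlam0 : 0 < 2 * α * σ := by positivity
  obtain ⟨hint, K, hK0, hK⟩ := DEKI.exists_integral_excess_le hw hu hS hAmax hz₀ hα hσ hh hC₀
    hlam0 hlam hstep
  refine ⟨hint, ⟨K, fun ε hε T hT => (hK ε hε T hT).trans ?_⟩, fun hτ => ?_⟩
  · have hτ1 : (1 : ℝ) ≤ τ ε := by exact_mod_cast hS.tau_pos ε hε
    have hlogτ := Real.log_nonneg hτ1
    have hlogT : 0 ≤ Real.log (T : ℝ) := Real.log_natCast_nonneg T
    gcongr
    nlinarith
  · exact DEKI.isBigO_of_le_rate hK0 hlam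
      (fun T => integral_nonneg fun ω => sub_nonneg.2 (DEKI.loss_zopt_le hS.nonneg hα zstar _))
      hK hτ
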